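/- **Setting.** Let $\emptyset\neq\mathcal O\subset\widehat{\mathbb R}^d$ be open. The Fourier transform is $\widehat f(\xi)=\int f(x)e^{-2\pi i x\cdot\xi}\,dx$. Let $Z(\mathcal O)=\mathcal F(C_c^\infty(\mathcal O))$ with the topology transported from $C_c^\infty(\mathcal O)$ by $\mathcal F$, and let $Z'(\mathcal O)$ be its topological dual with the weak-$*$ topology; for $f\in Z'(\mathcal O)$ put $\widehat f:=f\circ\mathcal F\in\mathcal D'(\mathcal O)$. Tempered distributions restrict to elements of $Z'(\mathcal O)$. A family $\mathcal Q=(Q_i)_{i\in I}$ of nonempty subsets of $\mathcal O$ with union $\mathcal O$ is an admissible cover if $N_{\mathcal Q}:=\sup_i|i^*|<\infty$, where $i^*=\{\ell\in I: Q_\ell\cap Q_i\neq\emptyset\}$. A BAPU subordinate to $\mathcal Q$ is a family $\Phi=(\varphi_i)_{i\in I}$ in $C_c^\infty(\mathcal O)$ with $\sum_i\varphi_i=1$ on $\mathcal O$, $\varphi_i=0$ on $\mathcal O\setminus Q_i$, and $C_\Phi:=\sup_i\|\mathcal F^{-1}\varphi_i\|_{L^1}<\infty$; put $\varphi_i^*=\sum_{\ell\in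 i^*}\varphi_\ell$. A weight $w\in(0,\infty)^I$ is $\mathcal Q$-moderate if $\sup_i\sup_{\ell\in i^*}w_i/w_\ell<\infty$, and $\|c\|_{\ell^q_w}=\|(w_ic_i)_i\|_{\ell^q}$. For $p,q\in[1,\infty]$, $\mathcal D(\mathcal Q,L^p,\ell^q_w)$ is the space of all $f\in Z'(\mathcal O)$ with $$\|f\|_{\mathcal D(\mathcal Q,L^p,\ell^q_w)}:=\big\|\big(\|\mathcal F^{-1}(\varphi_i\widehat f)\|_{L^p}\big)_{i}\big\|_{\ell^q_w}<\infty,$$ and $\ell^q_w(I;L^p)$ is the space of families $F=(F_i)_{i\in I}$ in $L^p(\mathbb R^d)$ with $\|F\|_{\ell^q_w(I;L^p)}:=\|(\|F_i\|_{L^p})_i\|_{\ell^q_w}<\infty$. For $F_i:\mathbb R^d\to[0,\infty)$, an $f\in Z'(\mathcal O)$ is $(F,\Phi)$-dominated if $|\mathcal F^{-1}(\varphi_i\widehat f)|\le F_i$ pointwise for all $i$ (the left side is a smooth function). For $S\in\mathcal FL^1(\mathbb R^d)$ and $T\in\mathcal FL^p(\mathbb R^d)$ put $S\odot T:=\mathcal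 F[(\mathcal F^{-1}S)*(\mathcal F^{-1}T)]$. **Proposition.** Let $\mathcal Q$ be an admissible cover of $\mathcal O$ with a subordinate BAPU $\Phi=(\varphi_i)_{i\in I}$. Call $h\in C(\mathcal O)$ tame if $C_h:=\sup_{i\in I}\|\mathcal F^{-1}(\varphi_ih)\|_{L^1}<\infty$. If $h$ is tame and $f\in\mathcal D(\mathcal Q,L^p,\ell^q_w)$ for some $p,q\in[1,\infty]$ and some $\mathcal Q$-moderate weight $w$, then every term of the series $$\Phi_hf:=\sum_{i\in I}\mathcal F^{-1}\big[(\varphi_i^*h)\odot(\varphi_i\widehat f)\big]$$ is well defined, and the series converges unconditionally in $Z'(\mathcal O)$. Moreover, for all $p,q\in[1,\infty]$ and all $\mathcal Q$-moderate weights $w$: (i) $\Phi_h$ is a bounded linear operator on $\mathcal D(\mathcal Q,L^p,\ell^q_w)$ with norm at most $N_{\mathcal Q}^2C_\Phi C_h$. (ii) Let $F=(F_i)_{i\in I}\in\ell^q_w(I;L^p)$ with $F_i\ge0$, let $f_n\in Z'(\mathcal O)$ ($n\in\mathbb N$) be $(F,\Phi)$-dominated, and let $f_n\to f$ in $Z'(\mathcal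 O)$. Then $f_n,f\in\mathcal D(\mathcal Q,L^p,\ell^q_w)$ and $\Phi_hf_n\to\Phi_hf$ in $Z'(\mathcal O)$, and there is $G\in\ell^q_w(I;L^p)$, $G_i\ge0$, such that $\Phi_hf_n$ is $(G,\Phi)$-dominated for all $n$ and $\|G\|_{\ell^q_w(I;L^p)}\le N_{\mathcal Q}^2C_\Phi C_h\|F\|_{\ell^q_w(I;L^p)}$. (iii) If $f\in\mathcal D(\mathcal Q,L^p,\ell^q_w)$ and $\widehat f\in C_c(\mathcal O)$, then $\Phi_hf=\mathcal F^{-1}(h\widehat f)$. (iv) If $g,h\in C(\mathcal O)$ are tame, then so is $g\cdot h$, and $\Phi_h\Phi_gf=\Phi_{gh}f$ for all $f\in\mathcal D(\mathcal Q,L^p,\ell^q_w)$. -/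

import Mathlib

open MeasureTheory TopologicalSpace Filter Topology
open scoped ENNReal NNReal ContDiff SchwartzMap FourierTransform Distributions Convolution

noncomputable section

namespace DecompSpaces

/-- Euclidean space of dimension `d`. -/
abbrev Rd (d : ℕ) : Type := EuclideanSpace ℝ (Fin d)

variable {d : ℕ} {O : Opens (Rd d)} {I : Type*}

/-! ### Test functions and Schwartz functions -/

/-- A smooth function supported in a fixed compact set, as a Schwartz function. -/
def supportedToSchwartz (K : Compacts (Rd d)) (f : 𝓓_{K}(Rd d, ℂ)) : 𝓢(Rd d, ℂ) :=
  HasCompactSupport.toSchwartzMap f.hasCompactSupport (by exact_mod_cast f.contDiff)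

theorem continuous_supportedToSchwartz (K : Compacts (Rd d)) :
    Continuous (supportedToSchwartz K) := by
  let A : 𝓓_{K}(Rd d, ℂ) →ₗ[ℝ] 𝓢(Rd d, ℂ) :=
    { toFun := supportedToSchwartz K
      map_add' := fun f g => SchwartzMap.ext fun x => rfl
      map_smul' := fun c f => SchwartzMap.ext fun x => rfl }
  change Continuous A
  refine WithSeminorms.continuous_of_isBounded
    (ContDiffMapSupportedIn.withSeminorms ℝ (Rd d) ℂ ⊤ K)
    (schwartz_withSeminorms ℝ (Rd d) ℂ) A (.of_real ?_)
  rintro ⟨k, n⟩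
  obtain ⟨R, hR⟩ := K.isCompact.isBounded.exists_norm_le
  refine ⟨{n}, (max R 0) ^ k, fun f => ?_⟩
  refine SchwartzMap.seminorm_le_bound ℝ k n (A f) (by
    exact mul_nonneg (by positivity) (apply_nonneg _ _)) fun x => ?_
  have e : (A f : Rd d → ℂ) = f := rfl
  rw [e]
  simp only [Finset.sup_singleton]
  by_cases hx : x ∈ K
  · refine mul_le_mul ?_ ?_ (norm_nonneg _) (by positivity)
    · exact pow_le_pow_left₀ (norm_nonneg _) ((hR x hx).trans (le_max_left _ _)) k
    · exact ContDiffMapSupportedIn.norm_iteratedFDeriv_apply_le_seminorm_top ℝ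
  · have h0 : iteratedFDeriv ℝ n f x = 0 := f.iteratedFDeriv_zero_on_compl hx
    rw [h0, norm_zero, mul_zero]
    exact mul_nonneg (by positivity) (apply_nonneg _ _)

/-- The continuous inclusion of `C_c^∞(O)` into the Schwartz space. -/
def testToSchwartz (O : Opens (Rd d)) : 𝓓(O, ℂ) →L[ℂ] 𝓢(Rd d, ℂ) :=
  TestFunction.mkCLM ℂ
    (fun f => HasCompactSupport.toSchwartzMap f.hasCompactSupport (by exact_mod_cast f.contDiff))
    (fun _ _ => SchwartzMap.ext fun _ => rfl) (fun _ _ => SchwartzMap.ext fun _ => rfl)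
    (fun K _ => continuous_supportedToSchwartz K)

/-- Multiplication by a fixed test function, `g ↦ φ · g`, from the Schwartz space to `C_c^∞(O)`. -/
def mulTest (φ : 𝓓(O, ℂ)) (g : 𝓢(Rd d, ℂ)) : 𝓓(O, ℂ) where
  toFun := fun ξ => φ ξ * g ξ
  contDiff' := by
    have h1 : ContDiff ℝ (((⊤ : ℕ∞)) : WithTop ℕ∞) φ := φ.contDiff
    exact h1.mul (g.smooth ⊤)
  hasCompactSupport' := φ.hasCompactSupport.mul_right
  tsupport_subset' := (tsupport_mul_subset_left).trans φ.tsupport_subset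

theorem continuous_mulTest (φ : 𝓓(O, ℂ)) : Continuous (mulTest φ) := by
  let K : Compacts (Rd d) := ⟨tsupport φ, φ.hasCompactSupport⟩
  have hφ : Function.HasTemperateGrowth (φ : Rd d → ℂ) :=
    (testToSchwartz O φ).hasTemperateGrowth
  let A : 𝓢(Rd d, ℂ) →ₗ[ℝ] 𝓓_{K}(Rd d, ℂ) :=
    { toFun := fun g => ⟨mulTest φ g, (mulTest φ g).contDiff, fun x hx => by
        have h0 : φ x = 0 := image_eq_zero_of_notMem_tsupport hx
        change φ x * g x = 0
        rw [h0, zero_mul]⟩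
      map_add' := fun f g => ContDiffMapSupportedIn.ext fun x => mul_add (φ x) (f x) (g x)
      map_smul' := fun c f => ContDiffMapSupportedIn.ext fun x => mul_smul_comm c (φ x) (f x) }
  have hK : (K : Set (Rd d)) ⊆ O := φ.tsupport_subset
  have hA : Continuous (SchwartzMap.smulLeftCLM ℂ (φ : Rd d → ℂ) : 𝓢(Rd d, ℂ) → 𝓢(Rd d, ℂ)) :=
    (SchwartzMap.smulLeftCLM ℂ (φ : Rd d → ℂ)).continuous
  have hcA : Continuous A := by
    refine WithSeminorms.continuous_of_isBounded (schwartz_withSeminorms ℝ (Rd d) ℂ)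
      (ContDiffMapSupportedIn.withSeminorms ℝ (Rd d) ℂ ⊤ K) A ?_
    intro n
    let L : 𝓢(Rd d, ℂ) →ₗ[ℝ] 𝓢(Rd d, ℂ) :=
      (SchwartzMap.smulLeftCLM ℂ (φ : Rd d → ℂ)).toLinearMap.restrictScalars ℝ
    have hq : Continuous ((SchwartzMap.seminorm ℝ 0 n).comp L) :=
      ((schwartz_withSeminorms ℝ (Rd d) ℂ).continuous_seminorm (0, n)).comp hA
    obtain ⟨s, C, -, hC⟩ := Seminorm.bound_of_continuous (schwartz_withSeminorms ℝ (Rd d) ℂ) _ hq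
    refine ⟨s, C, fun g => le_trans ?_ (hC g)⟩
    refine (ContDiffMapSupportedIn.seminorm_top_le_iff ℝ (apply_nonneg _ _) n (A g)).2
      fun x _ => ?_
    have e : (A g : Rd d → ℂ) = (L g : 𝓢(Rd d, ℂ)) := by
      funext y
      exact (SchwartzMap.smulLeftCLM_apply_apply hφ g y).symm
    rw [e]
    exact SchwartzMap.norm_iteratedFDeriv_le_seminorm ℝ (L g) n x
  exact (TestFunction.continuous_ofSupportedIn hK).comp hcA

/-! ### The space `Z(O)` of Fourier test functions and its dual `Z'(O)` -/

/-- The Fourier transform `C_c^∞(O) → 𝓢`. -/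
def fourierTestLM (O : Opens (Rd d)) : 𝓓(O, ℂ) →ₗ[ℂ] 𝓢(Rd d, ℂ) where
  toFun η := 𝓕 (testToSchwartz O η)
  map_add' f g := by rw [map_add, FourierTransform.fourier_add]
  map_smul' c f := by rw [map_smul, FourierTransform.fourier_smul, RingHom.id_apply]

/-- `Z(O) = 𝓕(C_c^∞(O))`. It is a type of its own because it does not carry the topology
induced by the Schwartz space. -/
def FourierTest (O : Opens (Rd d)) : Type := LinearMap.range (fourierTestLM O)

instance : AddCommGroup (FourierTest O) :=
  inferInstanceAs (AddCommGroup (LinearMap.range (fourierTestLM O)))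

instance : Module ℂ (FourierTest O) :=
  inferInstanceAs (Module ℂ (LinearMap.range (fourierTestLM O)))

/-- The Fourier transform `𝓕 : C_c^∞(O) → Z(O)`, a linear bijection. -/
def fourierZ (O : Opens (Rd d)) : 𝓓(O, ℂ) →ₗ[ℂ] FourierTest O :=
  (fourierTestLM O).rangeRestrict

/-- The topology of `Z(O)` is transported from `C_c^∞(O)` along the bijection `𝓕`
(see `fourierZ_isHomeomorph`). -/
instance : TopologicalSpace (FourierTest O) := coinduced (fourierZ O) inferInstance

/-- The inclusion `Z(O) ⊆ 𝓢`. -/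
def zToSchwartz (O : Opens (Rd d)) : FourierTest O →ₗ[ℂ] 𝓢(Rd d, ℂ) :=
  (LinearMap.range (fourierTestLM O)).subtype

theorem fourierZ_bijective (O : Opens (Rd d)) : Function.Bijective (fourierZ O) := by
  refine ⟨fun f g hfg => ?_, LinearMap.surjective_rangeRestrict _⟩
  have h1 : 𝓕 (testToSchwartz O f) = 𝓕 (testToSchwartz O g) := congrArg Subtype.val hfg
  have h2 : testToSchwartz O f = testToSchwartz O g := by
    have h3 := congrArg (fun x : 𝓢(Rd d, ℂ) => 𝓕⁻ x) h1
    simpa using h3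
  exact TestFunction.ext fun x => congrArg (fun s : 𝓢(Rd d, ℂ) => s x) h2

theorem fourierZ_isHomeomorph (O : Opens (Rd d)) : IsHomeomorph (fourierZ O) where
  continuous := continuous_coinduced_rng
  isOpenMap U hU := by
    refine isOpen_coinduced.2 ?_
    rwa [Set.preimage_image_eq _ (fourierZ_bijective O).1]
  bijective := fourierZ_bijective O

theorem continuous_zToSchwartz (O : Opens (Rd d)) : Continuous (zToSchwartz O) := by
  refine continuous_coinduced_dom.2 ?_
  change Continuous fun η => 𝓕 (testToSchwartz O η)
  exact (FourierTransform.fourierCLM ℂ 𝓢(Rd d, ℂ)).continuous.comp (testToSchwartz O).continuous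

/-- `Z'(O)`: the topological dual of `Z(O)`, with the weak-* topology. -/
abbrev FourierDist (O : Opens (Rd d)) : Type := WeakDual ℂ (FourierTest O)

/-- The Fourier transform `Z'(O) → 𝓓'(O)`, `f ↦ f ∘ 𝓕`. -/
def fourierZ' (f : FourierDist O) : 𝓓(O, ℂ) →L[ℂ] ℂ where
  toFun η := f (fourierZ O η)
  map_add' _ _ := by simp
  map_smul' _ _ := by simp
  cont := (map_continuous f).comp continuous_coinduced_rng

/-- The restriction `𝓢' → Z'(O)` of tempered distributions. -/
def toZ' (O : Opens (Rd d)) (T : 𝓢'(Rd d, ℂ)) : FourierDist O :=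
  StrongDual.toWeakDual
    { toFun := fun ψ => T (zToSchwartz O ψ)
      map_add' := fun _ _ => by simp
      map_smul' := fun _ _ => by simp
      cont := (map_continuous T).comp (continuous_zToSchwartz O) }

/-- The product `φ · T` of `φ ∈ C_c^∞(O)` and `T ∈ 𝓓'(O)`, as a tempered distribution. -/
def testMul (φ : 𝓓(O, ℂ)) (T : 𝓓(O, ℂ) →L[ℂ] ℂ) : 𝓢'(Rd d, ℂ) :=
  ContinuousLinearMap.toPointwiseConvergenceCLM _ _ _ _
    { toFun := fun g => T (mulTest φ g)
      map_add' := fun f g => by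
        rw [← map_add]
        exact congrArg T (TestFunction.ext fun x => mul_add (φ x) (f x) (g x))
      map_smul' := fun c f => by
        rw [RingHom.id_apply, ← map_smul]
        exact congrArg T (TestFunction.ext fun x => mul_smul_comm c (φ x) (f x))
      cont := T.continuous.comp (continuous_mulTest φ) }

/-! ### Functions as tempered distributions, and the generalized product -/

/-- The tempered distribution `T` is given by (integration against) the function `u`. -/
def IsGivenBy (T : 𝓢'(Rd d, ℂ)) (u : Rd d → ℂ) : Prop :=
  ∀ g : 𝓢(Rd d, ℂ), Integrable (fun x => u x * g x) ∧ T g = ∫ x, u x * g x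

open Classical in
/-- The tempered distribution given by the function `u`
(with value `0` if `u` does not define a tempered distribution). -/
def ofFun (u : Rd d → ℂ) : 𝓢'(Rd d, ℂ) :=
  if h : ∃ T, IsGivenBy T u then h.choose else 0

/-- The `L^p` norm, in `[0, ∞]`, of a tempered distribution; it is `∞` for distributions that are
not given by an `L^p` function. -/
def distLpNorm (p : ℝ≥0∞) (T : 𝓢'(Rd d, ℂ)) : ℝ≥0∞ :=
  ⨅ (u : Rd d → ℂ) (_ : MemLp u p) (_ : IsGivenBy T u), eLpNorm u p

/-- `R` is a generalized product of `S ∈ 𝓕L^1` and `T ∈ 𝓕L^p`: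
one has `𝓕⁻¹ R = (𝓕⁻¹ S) ∗ (𝓕⁻¹ T)`, with the convolution of an `L^1` and an `L^p` function. -/
def IsGenProd (p : ℝ≥0∞) (S T R : 𝓢'(Rd d, ℂ)) : Prop :=
  ∃ u v : Rd d → ℂ, MemLp u 1 ∧ MemLp v p ∧ IsGivenBy (𝓕⁻ S) u ∧ IsGivenBy (𝓕⁻ T) v ∧
    IsGivenBy (𝓕⁻ R) (u ⋆[ContinuousLinearMap.mul ℂ ℂ, volume] v)

open Classical in
/-- The generalized product `S ⊙ T = 𝓕[(𝓕⁻¹ S) ∗ (𝓕⁻¹ T)]` for `S ∈ 𝓕L^1` and `T ∈ 𝓕L^p` with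
some `p ∈ [1, ∞]` (with value `0` for all other pairs). -/
def genProd (S T : 𝓢'(Rd d, ℂ)) : 𝓢'(Rd d, ℂ) :=
  if h : ∃ R, ∃ p, 1 ≤ p ∧ IsGenProd p S T R then h.choose else 0

/-! ### Covers, weights, BAPUs and decomposition spaces -/

/-- `i^* = {ℓ : Q_ℓ ∩ Q_i ≠ ∅}`. -/
def cluster (Q : I → Set (Rd d)) (i : I) : Set I := {l | (Q l ∩ Q i).Nonempty}

/-- `N_Q = sup_i |i^*|`. -/
def overlapNum (Q : I → Set (Rd d)) : ℕ∞ := ⨆ i, (cluster Q i).encard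

structure IsAdmissibleCover (O : Opens (Rd d)) (Q : I → Set (Rd d)) : Prop where
  subset : ∀ i, Q i ⊆ O
  cover : (O : Set (Rd d)) = ⋃ i, Q i
  nonempty : ∀ i, (Q i).Nonempty
  overlap_lt_top : overlapNum Q < ⊤

structure IsModerateWeight (Q : I → Set (Rd d)) (w : I → ℝ) : Prop where
  pos : ∀ i, 0 < w i
  moderate : ∃ C : ℝ, ∀ i, ∀ l ∈ cluster Q i, w i / w l ≤ C

/-- `C_Φ = sup_i ‖𝓕⁻¹ φ_i‖_{L^1}`. -/
def bapuConst (φ : I → 𝓓(O, ℂ)) : ℝ≥0∞ := ⨆ i, eLpNorm (𝓕⁻ (φ i : Rd d → ℂ)) 1 volume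

/-- Bounded admissible partition of unity subordinate to `Q`. -/
structure IsBAPU (Q : I → Set (Rd d)) (φ : I → 𝓓(O, ℂ)) : Prop where
  sum_eq_one : ∀ ξ ∈ O, HasSum (fun i => φ i ξ) 1
  eq_zero : ∀ i, ∀ ξ ∈ (O : Set (Rd d)) \ Q i, φ i ξ = 0
  const_lt_top : bapuConst φ < ⊤

/-- The norm of `ℓ^q_w(I)` of a family in `[0, ∞]`. -/
def lqwNorm (q : ℝ≥0∞) (w : I → ℝ) (c : I → ℝ≥0∞) : ℝ≥0∞ :=
  if q = ⊤ then ⨆ i, ENNReal.ofReal (w i) * c i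
  else (∑' i, (ENNReal.ofReal (w i) * c i) ^ q.toReal) ^ (1 / q.toReal)

/-- `𝓕⁻¹(φ · f̂)` for `φ ∈ C_c^∞(O)` and `f ∈ Z'(O)`. -/
def localize (φ : 𝓓(O, ℂ)) (f : FourierDist O) : 𝓢'(Rd d, ℂ) := 𝓕⁻ (testMul φ (fourierZ' f))

/-- The norm of the decomposition space `𝓓(Q, L^p, ℓ^q_w)`, in `[0, ∞]`. -/
def decompNorm (φ : I → 𝓓(O, ℂ)) (p q : ℝ≥0∞) (w : I → ℝ) (f : FourierDist O) : ℝ≥0∞ :=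
  lqwNorm q w fun i => distLpNorm p (localize (φ i) f)

/-- The decomposition space `𝓓(Q, L^p, ℓ^q_w)`. -/
def decompSpace (φ : I → 𝓓(O, ℂ)) (p q : ℝ≥0∞) (w : I → ℝ) : Set (FourierDist O) :=
  {f | decompNorm φ p q w f < ⊤}

/-- The norm of `ℓ^q_w(I; L^p)`. -/
def mixedNorm (p q : ℝ≥0∞) (w : I → ℝ) (F : I → Rd d → ℝ) : ℝ≥0∞ :=
  lqwNorm q w fun i => eLpNorm (F i) p volume

/-- `F ∈ ℓ^q_w(I; L^p)` with nonnegative components. -/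
structure IsDominating (p q : ℝ≥0∞) (w : I → ℝ) (F : I → Rd d → ℝ) : Prop where
  nonneg : ∀ i x, 0 ≤ F i x
  memLp : ∀ i, MemLp (F i) p volume
  norm_lt_top : mixedNorm p q w F < ⊤

/-- `f` is `(F, Φ)`-dominated: `|𝓕⁻¹(φ_i f̂)| ≤ F_i` pointwise for all `i`, where the compactly
Fourier supported distribution `𝓕⁻¹(φ_i f̂)` is identified with its smooth density. -/
def IsDominated (φ : I → 𝓓(O, ℂ)) (F : I → Rd d → ℝ) (f : FourierDist O) : Prop :=
  ∀ i, ∃ u : Rd d → ℂ, ContDiff ℝ ∞ u ∧ IsGivenBy (localize (φ i) f) u ∧ ∀ x, ‖u x‖ ≤ F i x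

/-! ### Tame symbols and their Fourier multipliers -/

/-- `C_h = sup_i ‖𝓕⁻¹(φ_i h)‖_{L^1}`. -/
def tameConst (φ : I → 𝓓(O, ℂ)) (h : Rd d → ℂ) : ℝ≥0∞ :=
  ⨆ i, eLpNorm (𝓕⁻ (fun ξ => φ i ξ * h ξ)) 1 volume

/-- A continuous function on `O` (only its values on `O` matter) is tame if `C_h < ∞`. -/
structure IsTame (φ : I → 𝓓(O, ℂ)) (h : Rd d → ℂ) : Prop where
  continuousOn : ContinuousOn h O
  const_lt_top : tameConst φ h < ⊤

/-- `φ_i^* = ∑_{ℓ ∈ i^*} φ_ℓ`. -/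
def phiStar (Q : I → Set (Rd d)) (φ : I → 𝓓(O, ℂ)) (i : I) (ξ : Rd d) : ℂ :=
  ∑ᶠ l ∈ cluster Q i, φ l ξ

/-- The symbol `φ_i^* h` as a tempered distribution. -/
def starSymbol (Q : I → Set (Rd d)) (φ : I → 𝓓(O, ℂ)) (h : Rd d → ℂ) (i : I) : 𝓢'(Rd d, ℂ) :=
  ofFun fun ξ => phiStar Q φ i ξ * h ξ

/-- `𝓕⁻¹[(φ_i^* h) ⊙ (φ_i f̂)]`, as an element of `Z'(O)`. -/
def multSummand (Q : I → Set (Rd d)) (φ : I → 𝓓(O, ℂ)) (h : Rd d → ℂ) (f : FourierDist O) (i : I) :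
    FourierDist O :=
  toZ' O (𝓕⁻ (genProd (starSymbol Q φ h i) (testMul (φ i) (fourierZ' f))))

/-- `Φ_h f = ∑_i 𝓕⁻¹[(φ_i^* h) ⊙ (φ_i f̂)]`, an unconditional sum in `Z'(O)`. -/
def mult (Q : I → Set (Rd d)) (φ : I → 𝓓(O, ℂ)) (h : Rd d → ℂ) (f : FourierDist O) :
    FourierDist O :=
  ∑' i, multSummand Q φ h f i

end DecompSpaces

end

open DecompSpaces

noncomputable section

namespace DecompSpaces

variable {d : ℕ} {O : Opens (Rd d)} {I : Type*}

/-! ### Convolution of `L^1` and `L^p` functions -/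

section Convolution

variable {𝕜 : Type*} [RCLike 𝕜]

/-! Let `v i` be the `L^p` density of 𝓕⁻¹(φ_i f̂), and let a_i = 𝓕⁻¹(φ_i^* h) be the kernel
`starKer`. As a sum of at most N inverse transforms of φ_l h, it has `L^1` norm at most N C_h. The
i-th summand of Φ_h f is a_i ∗ v_i. Since h is only continuous, φ_i^* h cannot multiply f̂ directly.
Instead, `genProd_apply` and `fourierZ'_multSummand` express the pairing of the summand with η as ∫
a_i(y) f̂(e^{-2πi y·} φ_i η) dy, an average of values of f̂ on modulated test functions. Modulation
preserves supports, so only finitely many i contribute for η supported in a given compact set. This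
yields convergence and reduces every identity for Φ_h to finite sums and Fubini.

For the norm bound, φ_j times the transform of Φ_h f involves only i ∈ j^*. Moving φ_j next to f̂
gives the density Σ_{i ∈ j^*} 𝓕⁻¹φ_i ∗ a_i ∗ v_j (`isGivenBy_multDensity`). Young's inequality
bounds it by N · C_Φ · N C_h · ‖v_j‖, index by index, so the bound passes to the sequence norm.

For limits, the density of 𝓕⁻¹(φ_i f̂) at x is itself a value of f̂ on a modulation of φ_i
(`ae_eq_fourierZ'_modT`). Weak-* convergence therefore gives convergence of densities almost
everywhere, and dominated convergence does the rest. Replacing every factor in the density formula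
by its absolute value, and v_j by F_j, produces G.

For the algebraic statements, ∫ a(y) f̂(e^{-2πi y·} ψ) dy depends only on the product 𝓕a · ψ
(`integral_mul_fourierZ'_modT_congr`). Composition of multipliers convolves kernels, hence
multiplies symbols, and φ_i^* φ_i = φ_i with Σ φ_i = 1 identifies the results. -/

theorem aestronglyMeasurable_convolution {a v : Rd d → 𝕜} (ha : AEStronglyMeasurable a volume)
    (hv : AEStronglyMeasurable v volume) :
    AEStronglyMeasurable (a ⋆[ContinuousLinearMap.mul 𝕜 𝕜, volume] v) volume :=
  (ha.convolution_integrand (ContinuousLinearMap.mul 𝕜 𝕜) hv).integral_prod_right'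

theorem enorm_convolution_le (a v : Rd d → 𝕜) (x : Rd d) :
    ‖(a ⋆[ContinuousLinearMap.mul 𝕜 𝕜, volume] v) x‖ₑ ≤ ∫⁻ t, ‖a t‖ₑ * ‖v (x - t)‖ₑ := by
  rw [convolution_mul]
  refine (enorm_integral_le_lintegral_enorm _).trans_eq ?_
  simp_rw [enorm_mul]

/-- Young's inequality for an `L^1` and an `L^p` function. -/
theorem eLpNorm_convolution_le {p : ℝ≥0∞} (hp : 1 ≤ p) {a v : Rd d → 𝕜}
    (ha : AEStronglyMeasurable a volume) (hv : AEStronglyMeasurable v volume) :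
    eLpNorm (a ⋆[ContinuousLinearMap.mul 𝕜 𝕜, volume] v) p volume ≤
      eLpNorm a 1 volume * eLpNorm v p volume := by
  have hshift : ∀ x : Rd d, AEStronglyMeasurable (fun t => v (x - t)) volume := fun x =>
    hv.comp_quasiMeasurePreserving (quasiMeasurePreserving_sub_left volume x)
  rcases eq_or_ne p ⊤ with rfl | hpt
  · rw [eLpNorm_exponent_top (f := a ⋆[ContinuousLinearMap.mul 𝕜 𝕜, volume] v)]
    refine essSup_le_of_ae_le _ (Eventually.of_forall fun x => ?_)
    refine (enorm_convolution_le a v x).trans ?_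
    rw [eLpNorm_one_eq_lintegral_enorm, ← lintegral_mul_const'' _ ha.enorm]
    refine lintegral_mono_ae ?_
    have h1 : ∀ᵐ t, ‖v t‖ₑ ≤ eLpNorm v ⊤ volume := by
      rw [eLpNorm_exponent_top]; exact enorm_ae_le_eLpNormEssSup v volume
    filter_upwards [(quasiMeasurePreserving_sub_left volume x).ae h1] with t ht
    gcongr
  have hp0 : p ≠ 0 := (zero_lt_one.trans_le hp).ne'
  set r := p.toReal with hr
  have hr1 : 1 ≤ r := by
    rw [hr, ← ENNReal.toReal_one]; exact ENNReal.toReal_mono hpt hp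
  have hr0 : 0 < r := by linarith
  set A := ∫⁻ t, ‖a t‖ₑ with hA
  have hpt1 : ∀ x, ‖(a ⋆[ContinuousLinearMap.mul 𝕜 𝕜, volume] v) x‖ₑ ^ r ≤
      A ^ (r - 1) * ∫⁻ t, ‖a t‖ₑ * ‖v (x - t)‖ₑ ^ r := by
    intro x
    -- Hölder with weights 1 - 1/r and 1/r, after the splitting |a||v| = |a|^(1 - 1/r) ·
    -- (|a||v|^r)^(1/r). This form also covers r = 1.
    have h2 : ∫⁻ t, ‖a t‖ₑ * ‖v (x - t)‖ₑ ≤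
        A ^ (1 - 1 / r) * (∫⁻ t, ‖a t‖ₑ * ‖v (x - t)‖ₑ ^ r) ^ (1 / r) := by
      have h3 := ENNReal.lintegral_mul_norm_pow_le (μ := (volume : Measure (Rd d)))
        (f := fun t => ‖a t‖ₑ) (g := fun t => ‖a t‖ₑ * ‖v (x - t)‖ₑ ^ r) ha.enorm
        (ha.enorm.mul ((hshift x).enorm.pow_const r)) (p := 1 - 1 / r) (q := 1 / r)
        (by rw [sub_nonneg, div_le_one hr0]; exact hr1) (by positivity) (by ring)
      refine le_trans (le_of_eq (lintegral_congr fun t => ?_)) h3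
      rw [ENNReal.mul_rpow_of_nonneg _ _ (by positivity), ← ENNReal.rpow_mul, ← mul_assoc,
        ← ENNReal.rpow_add_of_nonneg _ _ (by rw [sub_nonneg, div_le_one hr0]; exact hr1)
          (by positivity), mul_one_div_cancel hr0.ne']
      simp
    calc _ ≤ (A ^ (1 - 1 / r) * (∫⁻ t, ‖a t‖ₑ * ‖v (x - t)‖ₑ ^ r) ^ (1 / r)) ^ r := by
          gcongr; exact (enorm_convolution_le a v x).trans h2
      _ = _ := by
          rw [ENNReal.mul_rpow_of_nonneg _ _ hr0.le, ← ENNReal.rpow_mul, ← ENNReal.rpow_mul,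
            one_div_mul_cancel hr0.ne', ENNReal.rpow_one, sub_mul, one_div_mul_cancel hr0.ne',
            one_mul]
  rw [eLpNorm_eq_lintegral_rpow_enorm_toReal hp0 hpt, eLpNorm_eq_lintegral_rpow_enorm_toReal hp0 hpt,
    eLpNorm_one_eq_lintegral_enorm, ← hr, ← hA]
  have hmeas : AEMeasurable (Function.uncurry fun x t : Rd d => ‖a t‖ₑ * ‖v (x - t)‖ₑ ^ r)
      (volume.prod volume) := by
    have h1 : AEMeasurable (fun z : Rd d × Rd d => ‖a z.2‖ₑ) (volume.prod volume) :=
      ha.enorm.comp_quasiMeasurePreserving Measure.quasiMeasurePreserving_snd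
    have h2 : AEMeasurable (fun z : Rd d × Rd d => ‖v (z.1 - z.2)‖ₑ) (volume.prod volume) :=
      hv.enorm.comp_quasiMeasurePreserving (quasiMeasurePreserving_sub_of_right_invariant volume volume)
    exact h1.mul (h2.pow_const r)
  calc _ ≤ (∫⁻ x, A ^ (r - 1) * ∫⁻ t, ‖a t‖ₑ * ‖v (x - t)‖ₑ ^ r) ^ (1 / r) := by
        gcongr with x; exact hpt1 x
    _ ≤ (A ^ (r - 1) * (A * ∫⁻ x, ‖v x‖ₑ ^ r)) ^ (1 / r) := by
        gcongr
        have hm' : AEMeasurable (fun x => ∫⁻ t, ‖a t‖ₑ * ‖v (x - t)‖ₑ ^ r) volume :=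
          hmeas.lintegral_prod_right'
        rw [lintegral_const_mul'' _ hm', lintegral_lintegral_swap hmeas]
        refine le_of_eq ?_
        congr 1
        rw [hA, ← lintegral_mul_const'' _ ha.enorm]
        refine lintegral_congr fun t => ?_
        have hvt : AEMeasurable (fun x => ‖v (x - t)‖ₑ ^ r) volume :=
          ((hv.comp_quasiMeasurePreserving
            (measurePreserving_sub_right volume t).quasiMeasurePreserving).enorm).pow_const r
        rw [lintegral_const_mul'' _ hvt]
        congr 1
        exact lintegral_sub_right_eq_self (fun x => ‖v x‖ₑ ^ r) t
    _ = _ := by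
        rw [← mul_assoc, ENNReal.mul_rpow_of_nonneg _ _ (by positivity)]
        congr 1
        nth_rewrite 2 [← ENNReal.rpow_one A]
        rw [← ENNReal.rpow_add_of_nonneg _ _ (by linarith) zero_le_one, sub_add_cancel,
          ← ENNReal.rpow_mul, mul_one_div_cancel hr0.ne', ENNReal.rpow_one]

theorem memLp_convolution {p : ℝ≥0∞} (hp : 1 ≤ p) {a v : Rd d → 𝕜} (ha : MemLp a 1 volume)
    (hv : MemLp v p volume) :
    MemLp (a ⋆[ContinuousLinearMap.mul 𝕜 𝕜, volume] v) p volume :=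
  ⟨aestronglyMeasurable_convolution ha.1 hv.1,
    (eLpNorm_convolution_le hp ha.1 hv.1).trans_lt (ENNReal.mul_lt_top ha.2 hv.2)⟩

theorem memLp_comp_add_right {q : ℝ≥0∞} {g : Rd d → 𝕜} (hg : MemLp g q volume) (y : Rd d) :
    MemLp (fun x => g (x + y)) q volume :=
  hg.comp_measurePreserving (measurePreserving_add_right volume y)

theorem eLpNorm_comp_add_right {q : ℝ≥0∞} {g : Rd d → 𝕜} (hg : MemLp g q volume) (y : Rd d) :
    eLpNorm (fun x => g (x + y)) q volume = eLpNorm g q volume :=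
  eLpNorm_comp_measurePreserving hg.1 (measurePreserving_add_right volume y)

theorem integral_norm_mul_le_toReal {p q : ℝ≥0∞} [p.HolderConjugate q] {v g : Rd d → 𝕜}
    (hv : MemLp v p volume) (hg : MemLp g q volume) :
    ∫ x, ‖v x * g x‖ ≤ (eLpNorm v p volume * eLpNorm g q volume).toReal := by
  have h : eLpNorm (fun x => v x * g x) 1 volume ≤ eLpNorm v p volume * eLpNorm g q volume := by
    simpa only [NNReal.coe_one, one_smul, ENNReal.coe_one, one_mul] using
      eLpNorm_le_eLpNorm_mul_eLpNorm_of_nnnorm (r := 1) hv.1 hg.1 (fun x y : 𝕜 => x * y) 1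
        (Eventually.of_forall fun x => by simp)
  have hm : AEStronglyMeasurable (fun x => v x * g x) volume := hv.1.mul hg.1
  rw [integral_norm_eq_lintegral_enorm hm, ← eLpNorm_one_eq_lintegral_enorm]
  exact ENNReal.toReal_mono (ENNReal.mul_ne_top hv.2.ne hg.2.ne) h

/-! ### Pairings of a convolution with a function of the conjugate exponent. -/

section Pairing

variable {p q : ℝ≥0∞} [p.HolderConjugate q] {a v g : Rd d → 𝕜}

theorem integrable_mul_of_memLp (hv : MemLp v p volume) (hg : MemLp g q volume) :
    Integrable (fun x => v x * g x) volume :=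
  hv.integrable_mul hg

theorem integrable_mul_comp_add (hv : MemLp v p volume) (hg : MemLp g q volume) (y : Rd d) :
    Integrable (fun x => v x * g (x + y)) volume :=
  hv.integrable_mul (memLp_comp_add_right hg y)

theorem norm_integral_mul_comp_add_le (hv : MemLp v p volume) (hg : MemLp g q volume) (y : Rd d) :
    ∫ x, ‖v x * g (x + y)‖ ≤ (eLpNorm v p volume * eLpNorm g q volume).toReal := by
  have := integral_norm_mul_le_toReal hv (memLp_comp_add_right hg y)
  rwa [eLpNorm_comp_add_right hg y] at this

theorem aestronglyMeasurable_snd_fst_add (ha : AEStronglyMeasurable a volume)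
    (hv : AEStronglyMeasurable v volume) (hg : AEStronglyMeasurable g volume) :
    AEStronglyMeasurable (fun z : Rd d × Rd d => a z.2 * (v z.1 * g (z.1 + z.2)))
      (volume.prod volume) :=
  (ha.comp_quasiMeasurePreserving Measure.quasiMeasurePreserving_snd).mul
    ((hv.comp_quasiMeasurePreserving Measure.quasiMeasurePreserving_fst).mul
      (hg.comp_quasiMeasurePreserving
        (Measure.quasiMeasurePreserving_fst.comp
          (measurePreserving_add_prod volume volume).quasiMeasurePreserving)))

/-- Integrating in the first variable first, Hölder bounds the inner integral by ‖v‖_p ‖g‖_q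
uniformly in the translation, and `a` is integrable. This is the absolute convergence behind every
use of Fubini below. -/
theorem integrable_triple (ha : MemLp a 1 volume) (hv : MemLp v p volume)
    (hg : MemLp g q volume) :
    Integrable (fun z : Rd d × Rd d => a z.2 * (v z.1 * g (z.1 + z.2)))
      (volume.prod volume) := by
  have hm := aestronglyMeasurable_snd_fst_add ha.1 hv.1 hg.1
  rw [integrable_prod_iff' hm]
  refine ⟨Eventually.of_forall fun y => (integrable_mul_comp_add hv hg y).const_mul (a y), ?_⟩
  refine Integrable.mono' (((memLp_one_iff_integrable.1 ha).norm).mul_const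
    (eLpNorm v p volume * eLpNorm g q volume).toReal) ?_ (Eventually.of_forall fun y => ?_)
  · exact hm.norm.prod_swap.integral_prod_right'
  · rw [Real.norm_of_nonneg (integral_nonneg fun x => norm_nonneg _)]
    simp_rw [norm_mul (a y)]
    rw [integral_const_mul]
    exact mul_le_mul_of_nonneg_left (norm_integral_mul_comp_add_le hv hg y) (norm_nonneg _)

theorem integral_integral_mul_comp_add (ha : MemLp a 1 volume) (hv : MemLp v p volume)
    (hg : MemLp g q volume) :
    ∫ y, a y * ∫ x, v x * g (x + y) = ∫ x, v x * ∫ y, a y * g (x + y) := by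
  have h := integral_integral_swap (f := fun x y => a y * (v x * g (x + y)))
    (integrable_triple ha hv hg)
  simp_rw [← integral_const_mul]
  rw [← h]
  refine integral_congr_ae (Eventually.of_forall fun x => integral_congr_ae
    (Eventually.of_forall fun y => ?_))
  simp only
  ring

theorem integrable_mul_integral (ha : MemLp a 1 volume) (hv : MemLp v p volume)
    (hg : MemLp g q volume) : Integrable (fun y => a y * ∫ x, v x * g (x + y)) volume := by
  have := (integrable_triple ha hv hg).integral_prod_right
  simpa only [integral_const_mul] using this

/-- The shear (x, y) ↦ (x - y, y) preserves the product measure and carries `integrable_triple` to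
the form in which convolution appears. -/
theorem integrable_triple_sub (ha : MemLp a 1 volume) (hv : MemLp v p volume)
    (hg : MemLp g q volume) :
    Integrable (fun z : Rd d × Rd d => a z.2 * (v (z.1 - z.2) * g z.1)) (volume.prod volume) := by
  have hmp := measurePreserving_sub_prod (volume : Measure (Rd d)) (volume : Measure (Rd d))
  refine (hmp.integrable_comp_of_integrable (integrable_triple ha hv hg)).congr
    (Eventually.of_forall fun z => ?_)
  simp

theorem integral_convolution_mul (ha : MemLp a 1 volume) (hv : MemLp v p volume)
    (hg : MemLp g q volume) :
    ∫ x, (a ⋆[ContinuousLinearMap.mul 𝕜 𝕜, volume] v) x * g x =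
      ∫ y, a y * ∫ x, v x * g (x + y) := by
  have hF := integrable_triple_sub ha hv hg
  have h := integral_integral_swap (f := fun x y => a y * (v (x - y) * g x)) hF
  calc _ = ∫ x, ∫ y, a y * (v (x - y) * g x) := by
        refine integral_congr_ae (Eventually.of_forall fun x => ?_)
        simp only [convolution_mul]
        rw [← integral_mul_const]
        simp_rw [mul_assoc]
    _ = _ := by
        rw [h]
        refine integral_congr_ae (Eventually.of_forall fun y => ?_)
        simp only
        rw [integral_const_mul, ← integral_add_right_eq_self _ y]
        simp

end Pairing

end Convolution

/-! ### Smoothness of the convolution of a Schwartz function and an `L^p` function -/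

section Smooth

theorem exists_schwartz_bound {F : Type} [NormedAddCommGroup F] [NormedSpace ℝ F]
    (ψ : 𝓢(Rd d, F)) (k : ℕ) : ∃ C : ℝ, 0 ≤ C ∧ ∀ x, (1 + ‖x‖) ^ k * ‖ψ x‖ ≤ C := by
  refine ⟨2 ^ k * ((Finset.Iic ((k, 0) : ℕ × ℕ)).sup
    fun m => SchwartzMap.seminorm ℝ m.1 m.2) ψ, by positivity, fun x => ?_⟩
  simpa using SchwartzMap.one_add_le_sup_seminorm_apply (𝕜 := ℝ) (m := (k, 0)) le_rfl le_rfl ψ x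

/-- Local domination of the translates of a Schwartz function. -/
theorem exists_schwartz_sub_bound {F : Type} [NormedAddCommGroup F] [NormedSpace ℝ F]
    (ψ : 𝓢(Rd d, F)) (k : ℕ) (x₀ : Rd d) : ∃ C : ℝ, 0 ≤ C ∧
      ∀ x ∈ Metric.ball x₀ 1, ∀ y, ‖ψ (x - y)‖ ≤ C * (1 + ‖y‖) ^ (-k : ℝ) := by
  obtain ⟨C, hC, h⟩ := exists_schwartz_bound ψ k
  refine ⟨C * (2 + ‖x₀‖) ^ k, by positivity, fun x hx y => ?_⟩
  have h1 := h (x - y)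
  have hx' : ‖x‖ ≤ ‖x₀‖ + 1 := by
    have := norm_sub_norm_le x x₀
    rw [Metric.mem_ball, dist_eq_norm] at hx
    linarith
  -- A Peetre-type inequality: decay in x - y becomes decay in y, uniformly for x in the unit ball
  -- around x₀.
  have h2 : 1 + ‖y‖ ≤ (2 + ‖x₀‖) * (1 + ‖x - y‖) := by
    have h3 : ‖y‖ ≤ ‖x‖ + ‖x - y‖ := by
      have := norm_sub_le x (x - y)
      simpa using this
    nlinarith [norm_nonneg x₀, norm_nonneg (x - y)]
  rw [Real.rpow_neg (by positivity), Real.rpow_natCast, ← div_eq_mul_inv,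
    le_div_iff₀ (by positivity)]
  calc ‖ψ (x - y)‖ * (1 + ‖y‖) ^ k ≤ ‖ψ (x - y)‖ * ((2 + ‖x₀‖) * (1 + ‖x - y‖)) ^ k := by
        gcongr
    _ = (1 + ‖x - y‖) ^ k * ‖ψ (x - y)‖ * (2 + ‖x₀‖) ^ k := by rw [mul_pow]; ring
    _ ≤ _ := by gcongr

/-- For large k the weight lies in the conjugate Lebesgue space, so Hölder applies. -/
theorem exists_integrable_weight {p : ℝ≥0∞} (hp : 1 ≤ p) {W : Rd d → ℂ} (hW : MemLp W p volume) :
    ∃ k : ℕ, Integrable (fun y => ‖W y‖ * (1 + ‖y‖) ^ (-k : ℝ)) volume := by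
  have : p.HolderConjugate (1 - p⁻¹)⁻¹ := ENNReal.HolderConjugate.inv_one_sub_inv' hp
  obtain ⟨k, hk⟩ := Measure.HasTemperateGrowth.exists_eLpNorm_lt_top (1 - p⁻¹)⁻¹
    (μ := (volume : Measure (Rd d))) inferInstance
  refine ⟨k, hW.norm.integrable_mul (q := (1 - p⁻¹)⁻¹) ⟨?_, hk⟩⟩
  refine Continuous.aestronglyMeasurable ?_
  refine Continuous.rpow_const (by fun_prop) fun x => Or.inl (by positivity)

theorem hasFDerivAt_integral_smul_schwartz {F : Type} [NormedAddCommGroup F] [NormedSpace ℂ F]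
    {p : ℝ≥0∞} (hp : 1 ≤ p)
    {W : Rd d → ℂ} (hW : MemLp W p volume) (ψ : 𝓢(Rd d, F)) (x₀ : Rd d) :
    HasFDerivAt (fun x => ∫ y, W y • ψ (x - y))
      (∫ y, W y • (SchwartzMap.fderivCLM ℝ (Rd d) F ψ) (x₀ - y)) x₀ := by
  obtain ⟨k, hk⟩ := exists_integrable_weight hp hW
  obtain ⟨C, hC, hψ⟩ := exists_schwartz_sub_bound ψ k x₀
  obtain ⟨C', hC', hψ'⟩ := exists_schwartz_sub_bound (SchwartzMap.fderivCLM ℝ (Rd d) F ψ) k x₀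
  have hm : ∀ x, AEStronglyMeasurable (fun y => W y • ψ (x - y)) volume := fun x =>
    hW.1.smul (ψ.continuous.comp (by fun_prop)).aestronglyMeasurable
  refine hasFDerivAt_integral_of_dominated_of_fderiv_le (𝕜 := ℝ)
    (F := fun x y => W y • ψ (x - y))
    (F' := fun x y => W y • (SchwartzMap.fderivCLM ℝ (Rd d) F ψ) (x - y))
    (bound := fun y => C' * (‖W y‖ * (1 + ‖y‖) ^ (-k : ℝ))) (s := Metric.ball x₀ 1)
    (Metric.ball_mem_nhds x₀ one_pos) (Eventually.of_forall hm) ?_ ?_ ?_ (hk.const_mul C') ?_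
  · refine (hk.const_mul C).mono' (hm x₀) (Eventually.of_forall fun y => ?_)
    rw [norm_smul]
    have := hψ x₀ (Metric.mem_ball_self one_pos) y
    calc _ ≤ ‖W y‖ * (C * (1 + ‖y‖) ^ (-k : ℝ)) := by gcongr
      _ = _ := by ring
  · exact hW.1.smul ((SchwartzMap.fderivCLM ℝ (Rd d) F ψ).continuous.comp
      (by fun_prop : Continuous fun y => x₀ - y)).aestronglyMeasurable
  · refine Eventually.of_forall fun y x hx => ?_
    rw [norm_smul]
    have := hψ' x hx y
    calc _ ≤ ‖W y‖ * (C' * (1 + ‖y‖) ^ (-k : ℝ)) := by gcongr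
      _ = _ := by ring
  · refine Eventually.of_forall fun y x _ => ?_
    have h1 : HasFDerivAt ψ (fderiv ℝ ψ (x - y)) (x - y) := ψ.differentiableAt.hasFDerivAt
    have h2 : HasFDerivAt (fun x => ψ (x - y)) (fderiv ℝ ψ (x - y)) x := by
      have h3 := h1.comp x ((hasFDerivAt_id x).sub_const y)
      rwa [ContinuousLinearMap.comp_id] at h3
    exact h2.const_smul (W y)

/-- Each derivative is an integral of the same shape with ψ replaced by its derivative. The target
space then changes to a space of linear maps, so `F` must be quantified inside the induction. -/
theorem contDiff_integral_smul_schwartz {p : ℝ≥0∞} (hp : 1 ≤ p)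
    {W : Rd d → ℂ} (hW : MemLp W p volume) (n : ℕ) :
    ∀ {F : Type} [NormedAddCommGroup F] [NormedSpace ℂ F] (ψ : 𝓢(Rd d, F)),
      ContDiff ℝ n (fun x => ∫ y, W y • ψ (x - y)) := by
  induction n with
  | zero =>
    intro F _ _ ψ
    exact contDiff_zero.2 (continuous_iff_continuousAt.2 fun x =>
      (hasFDerivAt_integral_smul_schwartz hp hW ψ x).continuousAt)
  | succ n ih =>
    intro F _ _ ψ
    refine contDiff_succ_iff_hasFDerivAt.2 ?_
    exact ⟨_, ih (SchwartzMap.fderivCLM ℝ (Rd d) F ψ),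
      hasFDerivAt_integral_smul_schwartz hp hW ψ⟩

theorem contDiff_convolution_schwartz {p : ℝ≥0∞} (hp : 1 ≤ p) (ψ : 𝓢(Rd d, ℂ))
    {W : Rd d → ℂ} (hW : MemLp W p volume) :
    ContDiff ℝ ∞ ((ψ : Rd d → ℂ) ⋆[ContinuousLinearMap.mul ℂ ℂ, volume] W) := by
  have h : ((ψ : Rd d → ℂ) ⋆[ContinuousLinearMap.mul ℂ ℂ, volume] W) =
      fun x => ∫ y, W y • ψ (x - y) := by
    funext x
    rw [convolution_mul_swap]
    simp_rw [smul_eq_mul, mul_comm]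
  rw [h]
  exact contDiff_infty.2 fun n => contDiff_integral_smul_schwartz hp hW n ψ

end Smooth

/-! ### The Fourier transform of a product -/

/-- The multiplication formula for `a` and η times the character at x, since that character shifts
𝓕η by x. It turns averages over translates of 𝓕η into a pointwise product on the frequency side. -/
theorem fourier_mul_fourier {a η : Rd d → ℂ} (ha : Integrable a volume)
    (hη : Integrable η volume) (x : Rd d) :
    𝓕 (fun ξ => 𝓕 a ξ * η ξ) x = ∫ y, a y * 𝓕 η (x + y) := by
  have key := VectorFourier.integral_fourierIntegral_smul_eq_flip (e := Real.fourierChar)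
    (μ := (volume : Measure (Rd d))) (ν := (volume : Measure (Rd d))) (L := innerₗ (Rd d))
    (f := a) (g := fun ξ => Real.fourierChar (-inner ℝ ξ x) • η ξ)
    Real.continuous_fourierChar continuous_inner ha
    (by
      have := (Real.fourierIntegral_convergent_iff x).2 hη
      simpa using this)
  rw [Real.fourier_eq]
  calc _ = ∫ ξ, 𝓕 a ξ • (Real.fourierChar (-inner ℝ ξ x) • η ξ) := by
        refine integral_congr_ae (Eventually.of_forall fun ξ => ?_)
        simp only [smul_eq_mul, Circle.smul_def]
        ring
    _ = _ := by
        refine key.trans (integral_congr_ae (Eventually.of_forall fun y => ?_))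
        simp only [smul_eq_mul]
        congr 1
        rw [Real.fourier_eq]
        refine integral_congr_ae (Eventually.of_forall fun ξ => ?_)
        simp only [Circle.smul_def, smul_eq_mul, ← mul_assoc]
        congr 1
        rw [← Circle.coe_mul, ← AddChar.map_add_eq_mul]
        congr 2
        simp [inner_add_right, real_inner_comm]

theorem integral_fourierInv_mul {f g : Rd d → ℂ} (hf : Integrable f volume)
    (hg : Integrable g volume) : ∫ x, 𝓕⁻ f x * g x = ∫ x, f x * 𝓕⁻ g x := by
  -- Negating the bilinear form turns the general Fourier integral into the inverse transform.
  have key := VectorFourier.integral_fourierIntegral_smul_eq_flip (e := Real.fourierChar)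
    (μ := (volume : Measure (Rd d))) (ν := (volume : Measure (Rd d))) (L := -innerₗ (Rd d))
    (f := f) (g := g) Real.continuous_fourierChar (by simp; fun_prop) hf hg
  have e1 : ∀ h : Rd d → ℂ, VectorFourier.fourierIntegral Real.fourierChar volume
      (-innerₗ (Rd d)) h = 𝓕⁻ h := by
    intro h; funext w; rw [Real.fourierInv_eq]; simp [VectorFourier.fourierIntegral]
  have e2 : (-innerₗ (Rd d)).flip = -innerₗ (Rd d) := by
    ext x y; simp [real_inner_comm]
  rw [e2, e1, e1] at key
  simpa using key

/-- The product of the Fourier transforms, in terms of inverse transforms and the convolution. -/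
theorem fourierInv_mul {a b : Rd d → ℂ} {A B : Rd d → ℂ} (hA : 𝓕 a = A) (hb : 𝓕⁻ B = b)
    (ha : Integrable a volume) (hB : Integrable B volume) :
    𝓕⁻ (fun ξ => A ξ * B ξ) = a ⋆[ContinuousLinearMap.mul ℂ ℂ, volume] b := by
  funext x
  subst hA hb
  rw [Real.fourierInv_eq_fourier_neg, fourier_mul_fourier ha hB, convolution_mul]
  refine integral_congr_ae (Eventually.of_forall fun y => ?_)
  simp only
  rw [Real.fourierInv_eq_fourier_neg]
  congr 2
  abel_nf

/-! ### Modulations -/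

/-- Multiplication of a Schwartz function by the character `ξ ↦ e^{-2πi y·ξ}`. -/
def modS (y : Rd d) (g : 𝓢(Rd d, ℂ)) : 𝓢(Rd d, ℂ) :=
  𝓕⁻ (SchwartzMap.compSubConstCLM ℂ (-y) (𝓕 g))

theorem fourier_modS_apply (y : Rd d) (g : 𝓢(Rd d, ℂ)) (x : Rd d) :
    𝓕 (modS y g) x = 𝓕 g (x + y) := by
  simp [modS]

/-- Conjugating a translation by the Fourier transform keeps `modS` in the Schwartz space by
construction; a change of variables in the inversion integral recovers the character. -/
theorem modS_apply (y : Rd d) (g : 𝓢(Rd d, ℂ)) (ξ : Rd d) :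
    modS y g ξ = (Real.fourierChar (-inner ℝ y ξ) : ℂ) * g ξ := by
  have h1 : g ξ = 𝓕⁻ (𝓕 g) ξ := by simp
  rw [h1, modS, SchwartzMap.fourierInv_coe, SchwartzMap.fourierInv_coe, Real.fourierInv_eq,
    Real.fourierInv_eq, ← integral_const_mul, ← integral_add_right_eq_self _ (-y)]
  refine integral_congr_ae (Eventually.of_forall fun x => ?_)
  simp only [SchwartzMap.compSubConstCLM_apply, Circle.smul_def, smul_eq_mul, ← mul_assoc]
  rw [← Circle.coe_mul, ← AddChar.map_add_eq_mul]
  simp [inner_add_left, add_comm]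

theorem testToSchwartz_apply (η : 𝓓(O, ℂ)) (ξ : Rd d) : testToSchwartz O η ξ = η ξ := rfl

theorem mulTest_apply (φ : 𝓓(O, ℂ)) (g : 𝓢(Rd d, ℂ)) (ξ : Rd d) : mulTest φ g ξ = φ ξ * g ξ := rfl

/-- Multiplication of a test function by the character `ξ ↦ e^{-2πi y·ξ}`. -/
def modT (y : Rd d) (η : 𝓓(O, ℂ)) : 𝓓(O, ℂ) where
  toFun := modS y (testToSchwartz O η)
  contDiff' := (modS y (testToSchwartz O η)).smooth ⊤
  hasCompactSupport' := by
    refine η.hasCompactSupport.mono fun ξ hξ => ?_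
    rw [Function.mem_support, modS_apply] at hξ
    exact right_ne_zero_of_mul hξ
  tsupport_subset' := by
    refine (closure_mono fun ξ hξ => ?_).trans η.tsupport_subset
    rw [Function.mem_support, modS_apply] at hξ
    exact right_ne_zero_of_mul hξ

theorem testToSchwartz_modT (y : Rd d) (η : 𝓓(O, ℂ)) :
    testToSchwartz O (modT y η) = modS y (testToSchwartz O η) := SchwartzMap.ext fun _ => rfl

theorem modT_apply (y : Rd d) (η : 𝓓(O, ℂ)) (ξ : Rd d) :
    modT y η ξ = (Real.fourierChar (-inner ℝ y ξ) : ℂ) * η ξ :=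
  modS_apply y (testToSchwartz O η) ξ

theorem mulTest_modS (φ : 𝓓(O, ℂ)) (y : Rd d) (g : 𝓢(Rd d, ℂ)) :
    mulTest φ (modS y g) = modT y (mulTest φ g) :=
  TestFunction.ext fun ξ => by
    rw [mulTest_apply, modT_apply, modS_apply, mulTest_apply]; ring

theorem modT_modT (y z : Rd d) (η : 𝓓(O, ℂ)) : modT y (modT z η) = modT (y + z) η :=
  TestFunction.ext fun ξ => by
    rw [modT_apply, modT_apply, modT_apply, inner_add_left, neg_add, AddChar.map_add_eq_mul,
      Circle.coe_mul, mul_assoc]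

/-! ### Distributions given by functions -/

theorem exists_isGivenBy {p : ℝ≥0∞} (hp : 1 ≤ p) {v : Rd d → ℂ} (hv : MemLp v p volume) :
    ∃ T : 𝓢'(Rd d, ℂ), IsGivenBy T v := by
  have : Fact (1 ≤ p) := ⟨hp⟩
  have := ENNReal.HolderConjugate.inv_one_sub_inv' hp
  refine ⟨Lp.toTemperedDistribution (hv.toLp v), fun g =>
    ⟨hv.integrable_mul (g.memLp (1 - p⁻¹)⁻¹), ?_⟩⟩
  rw [Lp.toTemperedDistribution_apply]
  refine integral_congr_ae ?_
  filter_upwards [hv.coeFn_toLp] with x hx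
  rw [hx, smul_eq_mul, mul_comm]

theorem IsGivenBy.add {T T' : 𝓢'(Rd d, ℂ)} {u u' : Rd d → ℂ} (h : IsGivenBy T u)
    (h' : IsGivenBy T' u') : IsGivenBy (T + T') (u + u') := fun g => by
  simp only [Pi.add_apply, add_mul]
  refine ⟨(h g).1.add (h' g).1, ?_⟩
  rw [integral_add (h g).1 (h' g).1, ← (h g).2, ← (h' g).2]
  rfl

theorem IsGivenBy.smul {T : 𝓢'(Rd d, ℂ)} {u : Rd d → ℂ} (h : IsGivenBy T u) (c : ℂ) :
    IsGivenBy (c • T) (c • u) := fun g => by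
  simp only [Pi.smul_apply, smul_eq_mul, mul_assoc]
  refine ⟨(h g).1.const_mul c, ?_⟩
  rw [integral_const_mul, ← (h g).2]
  rfl

theorem isGivenBy_ofFun {u : Rd d → ℂ} (h : ∃ T : 𝓢'(Rd d, ℂ), IsGivenBy T u) :
    IsGivenBy (ofFun u) u := by
  rw [ofFun, dif_pos h]
  exact h.choose_spec

theorem IsGivenBy.locallyIntegrable {T : 𝓢'(Rd d, ℂ)} {u : Rd d → ℂ} (h : IsGivenBy T u) :
    LocallyIntegrable u volume := by
  intro x
  let χ : ContDiffBump x := ⟨1, 2, one_pos, one_lt_two⟩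
  have h1 : HasCompactSupport (Complex.ofRealCLM ∘ χ) := χ.hasCompactSupport.comp_left rfl
  have h2 : ContDiff ℝ ∞ (Complex.ofRealCLM ∘ χ) := Complex.ofRealCLM.contDiff.comp χ.contDiff
  have h3 := (h (h1.toSchwartzMap h2)).1
  refine ⟨Metric.closedBall x 1, Metric.closedBall_mem_nhds x one_pos, ?_⟩
  refine (h3.integrableOn (s := Metric.closedBall x 1)).congr_fun (fun z hz => ?_)
    measurableSet_closedBall
  have h4 : χ z = 1 := χ.one_of_mem_closedBall hz
  simp [h4]

/-- Smooth compactly supported functions separate locally integrable ones. This uniqueness makes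
`distLpNorm` and `genProd` independent of the chosen densities. -/
theorem IsGivenBy.ae_eq {T : 𝓢'(Rd d, ℂ)} {u u' : Rd d → ℂ} (h : IsGivenBy T u)
    (h' : IsGivenBy T u') : u =ᵐ[volume] u' := by
  refine ae_eq_of_integral_contDiff_smul_eq h.locallyIntegrable h'.locallyIntegrable
    fun g hg hgc => ?_
  have h1 : HasCompactSupport (Complex.ofRealCLM ∘ g) := hgc.comp_left rfl
  have h2 : ContDiff ℝ ∞ (Complex.ofRealCLM ∘ g) := Complex.ofRealCLM.contDiff.comp hg
  have e : ∀ w : Rd d → ℂ, ∫ x, g x • w x = ∫ x, w x * (h1.toSchwartzMap h2) x := fun w => by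
    refine integral_congr_ae (Eventually.of_forall fun x => ?_)
    simp [mul_comm]
  rw [e, e, ← (h _).2, ← (h' _).2]

theorem distLpNorm_le {p : ℝ≥0∞} {T : 𝓢'(Rd d, ℂ)} {u : Rd d → ℂ} (hu : MemLp u p volume)
    (h : IsGivenBy T u) : distLpNorm p T ≤ eLpNorm u p volume :=
  iInf_le_of_le u (iInf_le_of_le hu (iInf_le _ h))

/-- The infimum is attained because all admissible densities agree almost everywhere. -/
theorem exists_of_distLpNorm_lt_top {p : ℝ≥0∞} {T : 𝓢'(Rd d, ℂ)} (h : distLpNorm p T < ⊤) :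
    ∃ u, MemLp u p volume ∧ IsGivenBy T u ∧ eLpNorm u p volume = distLpNorm p T := by
  obtain ⟨u, hu⟩ := iInf_lt_iff.1 h
  obtain ⟨hu1, hu⟩ := iInf_lt_iff.1 hu
  obtain ⟨hu2, -⟩ := iInf_lt_iff.1 hu
  refine ⟨u, hu1, hu2, le_antisymm ?_ (distLpNorm_le hu1 hu2)⟩
  refine le_iInf fun u' => le_iInf fun _ => le_iInf fun hu' => ?_
  rw [eLpNorm_congr_ae (hu2.ae_eq hu')]

/-! ### The generalized product -/

/-- The choice in `genProd` may come with another exponent and other densities; these agree almost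
everywhere with `u` and `v`, and convolution sees only almost-everywhere classes. -/
theorem isGivenBy_fourierInv_genProd {p : ℝ≥0∞} (hp : 1 ≤ p) {S T : 𝓢'(Rd d, ℂ)}
    {u v : Rd d → ℂ} (hu : MemLp u 1 volume) (hv : MemLp v p volume)
    (hS : IsGivenBy (𝓕⁻ S) u) (hT : IsGivenBy (𝓕⁻ T) v) :
    IsGivenBy (𝓕⁻ (genProd S T)) (u ⋆[ContinuousLinearMap.mul ℂ ℂ, volume] v) := by
  have hex : ∃ R, ∃ p, 1 ≤ p ∧ IsGenProd p S T R := by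
    obtain ⟨R, hR⟩ := exists_isGivenBy hp (memLp_convolution hp hu hv)
    refine ⟨𝓕 R, p, hp, u, v, hu, hv, hS, hT, ?_⟩
    rwa [FourierTransform.fourierInv_fourier_eq]
  rw [genProd, dif_pos hex]
  obtain ⟨p', -, u', v', -, -, hS', hT', hR⟩ := hex.choose_spec
  rwa [convolution_congr _ (hS'.ae_eq hS) (hT'.ae_eq hT)] at hR

theorem apply_eq_integral {T : 𝓢'(Rd d, ℂ)} {v : Rd d → ℂ} (hT : IsGivenBy (𝓕⁻ T) v)
    (g : 𝓢(Rd d, ℂ)) : T g = ∫ x, v x * 𝓕 g x := by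
  rw [← (hT (𝓕 g)).2, TemperedDistribution.fourierInv_apply,
    FourierTransform.fourierInv_fourier_eq]

/-- Fubini, together with the fact that translating 𝓕g amounts to modulating g. The density of `T`
disappears, which leaves a formula in the values of `T` alone. -/
theorem genProd_apply {p : ℝ≥0∞} (hp : 1 ≤ p) {S T : 𝓢'(Rd d, ℂ)}
    {u v : Rd d → ℂ} (hu : MemLp u 1 volume) (hv : MemLp v p volume)
    (hS : IsGivenBy (𝓕⁻ S) u) (hT : IsGivenBy (𝓕⁻ T) v) (g : 𝓢(Rd d, ℂ)) :
    genProd S T g = ∫ y, u y * T (modS y g) := by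
  have := ENNReal.HolderConjugate.inv_one_sub_inv' hp
  rw [apply_eq_integral (isGivenBy_fourierInv_genProd hp hu hv hS hT),
    integral_convolution_mul hu hv ((𝓕 g).memLp (1 - p⁻¹)⁻¹)]
  simp_rw [apply_eq_integral hT, fourier_modS_apply]

/-! ### Admissible covers and partitions of unity -/

section Cover

variable {Q : I → Set (Rd d)} {φ : I → 𝓓(O, ℂ)}

theorem IsAdmissibleCover.finite_cluster (hQ : IsAdmissibleCover O Q) (i : I) :
    (cluster Q i).Finite :=
  Set.encard_lt_top_iff.1 ((le_iSup (fun i => (cluster Q i).encard) i).trans_lt hQ.overlap_lt_top)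

/-- The cluster `i^*` as a finset. -/
def IsAdmissibleCover.clusterF (hQ : IsAdmissibleCover O Q) (i : I) : Finset I :=
  (hQ.finite_cluster i).toFinset

theorem IsAdmissibleCover.mem_clusterF (hQ : IsAdmissibleCover O Q) {i l : I} :
    l ∈ hQ.clusterF i ↔ (Q l ∩ Q i).Nonempty := by
  simp [clusterF, cluster]

theorem IsAdmissibleCover.card_clusterF_le (hQ : IsAdmissibleCover O Q) (i : I) :
    ((hQ.clusterF i).card : ℝ≥0∞) ≤ (overlapNum Q : ℝ≥0∞) := by
  have h : ((hQ.clusterF i).card : ℕ∞) ≤ overlapNum Q := by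
    refine le_trans (le_of_eq ?_) (le_iSup (fun i => (cluster Q i).encard) i)
    rw [← Set.encard_coe_eq_coe_finsetCard, clusterF, Set.Finite.coe_toFinset]
  have := ENat.toENNReal_le.2 h
  simpa using this

theorem IsBAPU.eq_zero_of_notMem (hφ : IsBAPU Q φ) {i : I} {ξ : Rd d} (h : ξ ∉ Q i) :
    φ i ξ = 0 := by
  by_cases hO : ξ ∈ O
  · exact hφ.eq_zero i ξ ⟨hO, h⟩
  · exact image_eq_zero_of_notMem_tsupport fun h' => hO ((φ i).tsupport_subset h')

theorem IsBAPU.mul_eq_zero_of_notMem (hφ : IsBAPU Q φ) (hQ : IsAdmissibleCover O Q) {i l : I}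
    (h : l ∉ hQ.clusterF i) (ξ : Rd d) : φ l ξ * φ i ξ = 0 := by
  by_contra h'
  refine h (hQ.mem_clusterF.2 ⟨ξ, ?_, ?_⟩) <;> by_contra h''
  · exact left_ne_zero_of_mul h' (hφ.eq_zero_of_notMem h'')
  · exact right_ne_zero_of_mul h' (hφ.eq_zero_of_notMem h'')

theorem IsBAPU.sum_eq_one_of_zero (hφ : IsBAPU Q φ) {ξ : Rd d} (hξ : ξ ∈ O) {s : Finset I}
    (hs : ∀ i ∉ s, φ i ξ = 0) : ∑ i ∈ s, φ i ξ = 1 :=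
  (hasSum_sum_of_ne_finset_zero hs).unique (hφ.sum_eq_one ξ hξ)

theorem phiStar_eq_sum (φ : I → 𝓓(O, ℂ)) (hQ : IsAdmissibleCover O Q) (i : I) (ξ : Rd d) :
    phiStar Q φ i ξ = ∑ l ∈ hQ.clusterF i, φ l ξ := by
  rw [phiStar, ← finsum_mem_coe_finset]
  congr 1
  funext l
  simp [IsAdmissibleCover.clusterF]

/-- Where φ_i does not vanish, every φ_l that does not vanish has l ∈ i^*, so the partial sum over
the cluster is already 1. -/
theorem IsBAPU.phiStar_mul (hφ : IsBAPU Q φ) (hQ : IsAdmissibleCover O Q) (i : I) (ξ : Rd d) :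
    phiStar Q φ i ξ * φ i ξ = φ i ξ := by
  by_cases h : φ i ξ = 0
  · rw [h, mul_zero]
  rw [phiStar_eq_sum φ hQ, hφ.sum_eq_one_of_zero ?_ fun l hl => ?_, one_mul]
  · exact (φ i).tsupport_subset (subset_tsupport _ h)
  · exact (mul_eq_zero.1 (hφ.mul_eq_zero_of_notMem hQ hl ξ)).resolve_right h

/-- The sets Q_i need not be open, but the sets {φ_i ≠ 0} are, and they cover O because the φ_i sum
to 1. A finite subcover of K, enlarged by its finite clusters, contains every index that is active
on K. -/
theorem IsBAPU.exists_finset_of_isCompact (hφ : IsBAPU Q φ) (hQ : IsAdmissibleCover O Q)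
    {K : Set (Rd d)} (hK : IsCompact K) (hKO : K ⊆ O) :
    ∃ s : Finset I, ∀ i ∉ s, ∀ ξ ∈ K, φ i ξ = 0 := by
  classical
  obtain ⟨t, ht⟩ := hK.elim_finite_subcover (fun i => {ξ | φ i ξ ≠ 0})
    (fun i => isOpen_ne_fun (φ i).continuous continuous_const) (fun ξ hξ => by
      by_contra h
      simp only [Set.mem_iUnion, Set.mem_ofPred_eq, not_exists, not_not] at h
      have h1 := hφ.sum_eq_one_of_zero (s := ∅) (hKO hξ) fun i _ => h i
      simp at h1)
  refine ⟨t.biUnion hQ.clusterF, fun i hi ξ hξ => ?_⟩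
  obtain ⟨l, hl, hlξ⟩ := Set.mem_iUnion₂.1 (ht hξ)
  have : i ∉ hQ.clusterF l := fun h => hi (Finset.mem_biUnion.2 ⟨l, hl, h⟩)
  exact (_root_.mul_eq_zero.1 (hφ.mul_eq_zero_of_notMem hQ this ξ)).resolve_right hlξ

theorem IsBAPU.exists_finset (hφ : IsBAPU Q φ) (hQ : IsAdmissibleCover O Q) (η : 𝓓(O, ℂ)) :
    ∃ s : Finset I, ∀ i ∉ s, ∀ ξ, φ i ξ * η ξ = 0 := by
  obtain ⟨s, hs⟩ := hφ.exists_finset_of_isCompact hQ η.hasCompactSupport η.tsupport_subset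
  refine ⟨s, fun i hi ξ => ?_⟩
  by_cases h : ξ ∈ tsupport η
  · rw [hs i hi ξ h, zero_mul]
  · rw [image_eq_zero_of_notMem_tsupport h, mul_zero]

theorem IsBAPU.sum_mul_eq (hφ : IsBAPU Q φ) {η : 𝓓(O, ℂ)} {s : Finset I}
    (hs : ∀ i ∉ s, ∀ ξ, φ i ξ * η ξ = 0) (ξ : Rd d) : ∑ i ∈ s, φ i ξ * η ξ = η ξ := by
  by_cases h : η ξ = 0
  · simp [h]
  rw [← Finset.sum_mul, hφ.sum_eq_one_of_zero (η.tsupport_subset (subset_tsupport _ h))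
    fun i hi => (mul_eq_zero.1 (hs i hi ξ)).resolve_right h, one_mul]

theorem testFunction_sum_apply {ι : Type*} (s : Finset ι) (η : ι → 𝓓(O, ℂ)) (ξ : Rd d) :
    (∑ i ∈ s, η i) ξ = ∑ i ∈ s, η i ξ := by
  classical
  induction s using Finset.induction_on with
  | empty => rfl
  | insert i s hi ih =>
    rw [Finset.sum_insert hi, Finset.sum_insert hi, ← ih]
    rfl

theorem IsBAPU.sum_mulTest (hφ : IsBAPU Q φ) {η : 𝓓(O, ℂ)} {s : Finset I}
    (hs : ∀ i ∉ s, ∀ ξ, φ i ξ * η ξ = 0) : ∑ i ∈ s, mulTest (φ i) (testToSchwartz O η) = η :=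
  TestFunction.ext fun ξ => by
    rw [testFunction_sum_apply]
    exact hφ.sum_mul_eq hs ξ

end Cover

/-! ### The kernels `𝓕⁻¹(φ_i^* h)` -/

section Kernel

variable {Q : I → Set (Rd d)} {φ : I → 𝓓(O, ℂ)} {h : Rd d → ℂ}

/-- Outside O the values of `h` are arbitrary; they are harmless because the closed support of `k`
stays inside O. -/
theorem continuous_mul_of_tsupport_subset {k : Rd d → ℂ} (hk : Continuous k)
    (hkO : tsupport k ⊆ O) (hh : ContinuousOn h O) : Continuous fun ξ => k ξ * h ξ := by
  refine ContinuousOn.continuous_of_tsupport_subset (hk.continuousOn.mul hh) O.isOpen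
    ((closure_mono fun ξ hξ => ?_).trans hkO)
  exact left_ne_zero_of_mul hξ

theorem memLp_one_of_mul {k : Rd d → ℂ} (hk : Continuous k) (hkc : HasCompactSupport k)
    (hkO : tsupport k ⊆ O) (hh : ContinuousOn h O) : MemLp (fun ξ => k ξ * h ξ) 1 volume :=
  memLp_one_iff_integrable.2
    ((continuous_mul_of_tsupport_subset hk hkO hh).integrable_of_hasCompactSupport hkc.mul_right)

theorem continuous_fourierInv {g : Rd d → ℂ} (hg : Integrable g volume) : Continuous (𝓕⁻ g) :=
  VectorFourier.fourierIntegral_continuous Real.continuous_fourierChar (by simp; fun_prop) hg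

/-- The function `φ_i^* h`. -/
def starFun (Q : I → Set (Rd d)) (φ : I → 𝓓(O, ℂ)) (h : Rd d → ℂ) (i : I) (ξ : Rd d) : ℂ :=
  phiStar Q φ i ξ * h ξ

/-- The kernel `𝓕⁻¹(φ_i^* h)`. -/
def starKer (Q : I → Set (Rd d)) (φ : I → 𝓓(O, ℂ)) (h : Rd d → ℂ) (i : I) : Rd d → ℂ :=
  𝓕⁻ (starFun Q φ h i)

theorem integrable_mul_tame (φ : 𝓓(O, ℂ)) (hh : ContinuousOn h O) :
    Integrable (fun ξ => φ ξ * h ξ) volume :=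
  memLp_one_iff_integrable.1 (memLp_one_of_mul φ.continuous φ.hasCompactSupport φ.tsupport_subset hh)

theorem starFun_eq_sum (φ : I → 𝓓(O, ℂ)) (hQ : IsAdmissibleCover O Q) (h : Rd d → ℂ) (i : I) :
    starFun Q φ h i = fun ξ => ∑ l ∈ hQ.clusterF i, φ l ξ * h ξ := by
  funext ξ
  rw [starFun, phiStar_eq_sum φ hQ, Finset.sum_mul]

theorem continuous_starFun (φ : I → 𝓓(O, ℂ)) (hQ : IsAdmissibleCover O Q)
    (hh : ContinuousOn h O) (i : I) : Continuous (starFun Q φ h i) := by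
  rw [starFun_eq_sum φ hQ]
  exact continuous_finsetSum _ fun l _ =>
    continuous_mul_of_tsupport_subset (φ l).continuous (φ l).tsupport_subset hh

theorem integrable_starFun (φ : I → 𝓓(O, ℂ)) (hQ : IsAdmissibleCover O Q)
    (hh : ContinuousOn h O) (i : I) : Integrable (starFun Q φ h i) volume := by
  rw [starFun_eq_sum φ hQ]
  exact integrable_finsetSum _ fun l _ => integrable_mul_tame (φ l) hh

theorem memLp_fourierInv_mul_tame (hh : IsTame φ h) (i : I) :
    MemLp (𝓕⁻ (fun ξ => φ i ξ * h ξ)) 1 volume :=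
  ⟨(continuous_fourierInv (integrable_mul_tame (φ i) hh.continuousOn)).aestronglyMeasurable,
    (le_iSup (fun i => eLpNorm (𝓕⁻ (fun ξ => φ i ξ * h ξ)) 1 volume) i).trans_lt hh.const_lt_top⟩

theorem starKer_eq_sum (φ : I → 𝓓(O, ℂ)) (hQ : IsAdmissibleCover O Q) (hh : ContinuousOn h O)
    (i : I) : starKer Q φ h i = ∑ l ∈ hQ.clusterF i, 𝓕⁻ (fun ξ => φ l ξ * h ξ) := by
  funext x
  rw [starKer, starFun_eq_sum φ hQ, Finset.sum_apply]
  simp_rw [Real.fourierInv_eq, Finset.smul_sum]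
  refine integral_finsetSum _ fun l _ => ?_
  have := (Real.fourierIntegral_convergent_iff (-x)).2 (integrable_mul_tame (φ l) hh)
  simpa using this

theorem memLp_starKer (hQ : IsAdmissibleCover O Q) (hh : IsTame φ h) (i : I) :
    MemLp (starKer Q φ h i) 1 volume := by
  rw [starKer_eq_sum φ hQ hh.continuousOn]
  exact memLp_finsetSum' _ fun l _ => memLp_fourierInv_mul_tame hh l

theorem eLpNorm_starKer_le (hQ : IsAdmissibleCover O Q) (hh : IsTame φ h) (i : I) :
    eLpNorm (starKer Q φ h i) 1 volume ≤ (overlapNum Q : ℝ≥0∞) * tameConst φ h := by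
  rw [starKer_eq_sum φ hQ hh.continuousOn]
  refine (eLpNorm_sum_le (fun l _ => (memLp_fourierInv_mul_tame hh l).1) le_rfl).trans ?_
  refine (Finset.sum_le_card_nsmul _ _ (tameConst φ h) fun l _ =>
    le_iSup (fun i => eLpNorm (𝓕⁻ (fun ξ => φ i ξ * h ξ)) 1 volume) l).trans ?_
  rw [nsmul_eq_mul]
  gcongr
  exact hQ.card_clusterF_le i

/-- Fourier inversion for a continuous integrable function; tameness supplies the integrability of
its transform. -/
theorem fourier_starKer (hQ : IsAdmissibleCover O Q) (hh : IsTame φ h) (i : I) :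
    𝓕 (starKer Q φ h i) = starFun Q φ h i := by
  have hc := continuous_starFun φ hQ hh.continuousOn i
  have hi := integrable_starFun φ hQ hh.continuousOn i
  refine hc.fourier_fourierInv_eq hi ?_
  have h1 : Integrable (starKer Q φ h i) volume := memLp_one_iff_integrable.1 (memLp_starKer hQ hh i)
  have h2 : 𝓕 (starFun Q φ h i) = fun x => starKer Q φ h i (-x) := by
    funext x
    rw [starKer, Real.fourierInv_eq_fourier_neg, neg_neg]
  rw [h2]
  exact h1.comp_neg

theorem isGivenBy_starSymbol (hQ : IsAdmissibleCover O Q) (hh : ContinuousOn h O) (i : I) :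
    IsGivenBy (starSymbol Q φ h i) (starFun Q φ h i) :=
  isGivenBy_ofFun (exists_isGivenBy le_rfl
    (memLp_one_iff_integrable.2 (integrable_starFun φ hQ hh i)))

theorem isGivenBy_fourierInv_starSymbol (hQ : IsAdmissibleCover O Q) (hh : IsTame φ h) (i : I) :
    IsGivenBy (𝓕⁻ (starSymbol Q φ h i)) (starKer Q φ h i) := fun g => by
  refine ⟨(memLp_starKer hQ hh i).integrable_mul (g.memLp ⊤), ?_⟩
  rw [TemperedDistribution.fourierInv_apply,
    (isGivenBy_starSymbol hQ hh.continuousOn i (𝓕⁻ g)).2, SchwartzMap.fourierInv_coe]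
  exact (integral_fourierInv_mul (integrable_starFun φ hQ hh.continuousOn i) g.integrable).symm

end Kernel

/-! ### Locally finite sums in `Z'(O)` -/

section Sums

/-- The Fourier transform as a linear equivalence `C_c^∞(O) ≃ Z(O)`. -/
def fourierZEquiv (O : Opens (Rd d)) : 𝓓(O, ℂ) ≃ₗ[ℂ] FourierTest O :=
  LinearEquiv.ofBijective (fourierZ O) (fourierZ_bijective O)

/-- The element of `Z'(O)` with a given Fourier transform in `𝓓'(O)`. -/
def ofFourierZ' (T : 𝓓(O, ℂ) →L[ℂ] ℂ) : FourierDist O :=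
  StrongDual.toWeakDual
    { toLinearMap := T.toLinearMap ∘ₗ (fourierZEquiv O).symm.toLinearMap
      cont := by
        refine continuous_coinduced_dom.2 (T.continuous.congr fun η => ?_)
        exact congrArg T ((fourierZEquiv O).symm_apply_apply η).symm }

theorem ofFourierZ'_apply (T : 𝓓(O, ℂ) →L[ℂ] ℂ) (η : 𝓓(O, ℂ)) :
    ofFourierZ' T (fourierZ O η) = T η :=
  congrArg T ((fourierZEquiv O).symm_apply_apply η)

theorem fourierDist_ext {f g : FourierDist O} (h : ∀ η, fourierZ' f η = fourierZ' g η) : f = g := by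
  refine ContinuousLinearMap.ext fun ψ => ?_
  obtain ⟨η, rfl⟩ := (fourierZ_bijective O).2 ψ
  exact h η

theorem tendsto_fourierDist_iff {ι : Type*} {l : Filter ι} {f : ι → FourierDist O}
    {g : FourierDist O} :
    Tendsto f l (𝓝 g) ↔ ∀ η, Tendsto (fun n => fourierZ' (f n) η) l (𝓝 (fourierZ' g η)) := by
  rw [tendsto_iff_forall_eval_tendsto_topDualPairing]
  refine ⟨fun h η => h _, fun h ψ => ?_⟩
  obtain ⟨η, rfl⟩ := (fourierZ_bijective O).2 ψ
  exact h η

theorem fourierZ'_sum (s : Finset I) (G : I → FourierDist O) (η : 𝓓(O, ℂ)) :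
    fourierZ' (∑ i ∈ s, G i) η = ∑ i ∈ s, fourierZ' (G i) η := by
  classical
  induction s using Finset.induction_on with
  | empty => rfl
  | insert i s hi ih =>
    rw [Finset.sum_insert hi, Finset.sum_insert hi, ← ih]
    rfl

/-- A locally finite family in `Z'(O)` is summable. -/
theorem summable_of_locallyFinite (G : I → FourierDist O)
    (hG : ∀ K : Set (Rd d), IsCompact K → K ⊆ O →
      ∃ s : Finset I, ∀ i ∉ s, ∀ η : 𝓓(O, ℂ), tsupport η ⊆ K → fourierZ' (G i) η = 0) :
    Summable G := by
  have hη : ∀ η : 𝓓(O, ℂ), Summable fun i => fourierZ' (G i) η := fun η => by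
    obtain ⟨s, hs⟩ := hG _ η.hasCompactSupport η.tsupport_subset
    exact summable_of_ne_finset_zero (s := s) fun i hi => hs i hi η subset_rfl
  let T : 𝓓(O, ℂ) →L[ℂ] ℂ := TestFunction.mkCLM ℂ (fun η => ∑' i, fourierZ' (G i) η)
    (fun f g => by simp_rw [map_add]; exact (hη f).tsum_add (hη g))
    (fun c f => by simp_rw [map_smul]; exact (hη f).tsum_const_smul c)
    -- Continuity of the sum is tested on each space of functions supported in K, where one finite
    -- index set serves all test functions.
    (fun K hK => by
      obtain ⟨s, hs⟩ := hG K K.isCompact hK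
      have hc : Continuous fun f : 𝓓_{K}(Rd d, ℂ) =>
          ∑ i ∈ s, fourierZ' (G i) (TestFunction.ofSupportedIn hK f) :=
        continuous_finsetSum _ fun i _ =>
          (fourierZ' (G i)).continuous.comp (TestFunction.continuous_ofSupportedIn hK)
      refine hc.congr fun f => (tsum_eq_sum fun i hi => hs i hi _ ?_).symm
      exact f.tsupport_subset)
  refine ⟨ofFourierZ' T, tendsto_fourierDist_iff.2 fun η => ?_⟩
  simp_rw [fourierZ'_sum]
  have e : fourierZ' (ofFourierZ' T) η = ∑' i, fourierZ' (G i) η := ofFourierZ'_apply T η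
  rw [e]
  exact (hη η).hasSum

theorem fourierZ'_tsum {G : I → FourierDist O} (hG : Summable G) {η : 𝓓(O, ℂ)} {s : Finset I}
    (hs : ∀ i ∉ s, fourierZ' (G i) η = 0) :
    fourierZ' (∑' i, G i) η = ∑ i ∈ s, fourierZ' (G i) η := by
  have h1 := tendsto_fourierDist_iff.1 hG.hasSum η
  simp_rw [fourierZ'_sum] at h1
  have h2 : HasSum (fun i => fourierZ' (G i) η) (fourierZ' (∑' i, G i) η) := h1
  exact h2.unique (hasSum_sum_of_ne_finset_zero hs)

end Sums

/-! ### Pairings with modulated test functions -/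

section Pairing

variable {Q : I → Set (Rd d)} {φ : I → 𝓓(O, ℂ)} {h : Rd d → ℂ} {p : ℝ≥0∞} {f : FourierDist O}
  {v : I → Rd d → ℂ}

/-- Each `𝓕⁻¹(φ_i f̂)` is given by the `L^p` function `v_i`. -/
def LocGiven (φ : I → 𝓓(O, ℂ)) (p : ℝ≥0∞) (f : FourierDist O) (v : I → Rd d → ℂ) : Prop :=
  ∀ i, MemLp (v i) p volume ∧ IsGivenBy (localize (φ i) f) (v i)

theorem fourierZ'_mulTest {φ : 𝓓(O, ℂ)} {v : Rd d → ℂ} (hv : IsGivenBy (localize φ f) v)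
    (g : 𝓢(Rd d, ℂ)) : fourierZ' f (mulTest φ g) = ∫ x, v x * 𝓕 g x :=
  apply_eq_integral hv g

theorem fourierZ'_modT_mulTest {φ : 𝓓(O, ℂ)} {v : Rd d → ℂ} (hv : IsGivenBy (localize φ f) v)
    (g : 𝓢(Rd d, ℂ)) (y : Rd d) :
    fourierZ' f (modT y (mulTest φ g)) = ∫ x, v x * 𝓕 g (x + y) := by
  rw [← mulTest_modS, fourierZ'_mulTest hv]
  simp_rw [fourier_modS_apply]

theorem modT_sum {ι : Type*} (s : Finset ι) (η : ι → 𝓓(O, ℂ)) (y : Rd d) :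
    modT y (∑ i ∈ s, η i) = ∑ i ∈ s, modT y (η i) :=
  TestFunction.ext fun ξ => by
    simp_rw [modT_apply, testFunction_sum_apply, modT_apply, Finset.mul_sum]

/-- Split ψ by the partition of unity before modulating: the finite index set then does not depend
on y, which later permits integration in y term by term. -/
theorem fourierZ'_modT (hφ : IsBAPU Q φ) (hv : LocGiven φ p f v) {ψ : 𝓓(O, ℂ)} {s : Finset I}
    (hs : ∀ i ∉ s, ∀ ξ, φ i ξ * ψ ξ = 0) (y : Rd d) :
    fourierZ' f (modT y ψ) = ∑ k ∈ s, ∫ x, v k x * 𝓕 (testToSchwartz O ψ) (x + y) := by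
  conv_lhs => rw [← hφ.sum_mulTest hs, modT_sum, map_sum]
  exact Finset.sum_congr rfl fun k _ => fourierZ'_modT_mulTest (hv k).2 _ y

theorem integrable_mul_fourierZ'_modT (hp : 1 ≤ p) (hφ : IsBAPU Q φ) (hQ : IsAdmissibleCover O Q)
    (hv : LocGiven φ p f v) {a : Rd d → ℂ} (ha : MemLp a 1 volume) (ψ : 𝓓(O, ℂ)) :
    Integrable (fun y => a y * fourierZ' f (modT y ψ)) volume := by
  have := ENNReal.HolderConjugate.inv_one_sub_inv' hp
  obtain ⟨s, hs⟩ := hφ.exists_finset hQ ψ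
  simp_rw [fourierZ'_modT hφ hv hs, Finset.mul_sum]
  exact integrable_finsetSum _ fun k _ => integrable_mul_integral ha (hv k).1
    ((𝓕 (testToSchwartz O ψ)).memLp (1 - p⁻¹)⁻¹)

/-- The pairing of `f̂` with `𝓕a · ψ` depends only on the product `𝓕a · ψ`. -/
theorem integral_mul_fourierZ'_modT_congr (hp : 1 ≤ p) (hφ : IsBAPU Q φ)
    (hQ : IsAdmissibleCover O Q) (hv : LocGiven φ p f v) {a b : Rd d → ℂ}
    (ha : MemLp a 1 volume) (hb : MemLp b 1 volume) {ψ χ : 𝓓(O, ℂ)}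
    (hab : ∀ ξ, 𝓕 a ξ * ψ ξ = 𝓕 b ξ * χ ξ) :
    ∫ y, a y * fourierZ' f (modT y ψ) = ∫ y, b y * fourierZ' f (modT y χ) := by
  classical
  have := ENNReal.HolderConjugate.inv_one_sub_inv' hp
  obtain ⟨s, hs⟩ := hφ.exists_finset hQ ψ
  obtain ⟨t, ht⟩ := hφ.exists_finset hQ χ
  -- Fubini and `fourier_mul_fourier` bring either side to Σ_k ∫ v_k · 𝓕(𝓕a · ψ). The index set s ∪
  -- t is common to both sides, so the sums can be compared directly.
  have key : ∀ {a : Rd d → ℂ} (_ : MemLp a 1 volume) {ψ : 𝓓(O, ℂ)}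
      (_ : ∀ i ∉ s ∪ t, ∀ ξ, φ i ξ * ψ ξ = 0), ∫ y, a y * fourierZ' f (modT y ψ) =
        ∑ k ∈ s ∪ t, ∫ x, v k x * 𝓕 (fun ξ => 𝓕 a ξ * ψ ξ) x := by
    intro a ha ψ hψ
    have hm := (𝓕 (testToSchwartz O ψ)).memLp (1 - p⁻¹)⁻¹ volume
    simp_rw [fourierZ'_modT hφ hv hψ, Finset.mul_sum]
    rw [integral_finsetSum _ fun k _ => integrable_mul_integral ha (hv k).1 hm]
    refine Finset.sum_congr rfl fun k _ => ?_
    rw [integral_integral_mul_comp_add ha (hv k).1 hm]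
    refine integral_congr_ae (Eventually.of_forall fun x => ?_)
    simp only
    congr 1
    exact (fourier_mul_fourier (memLp_one_iff_integrable.1 ha)
      (testToSchwartz O ψ).integrable x).symm
  rw [key ha fun i hi => hs i fun h => hi (Finset.mem_union_left _ h),
    key hb fun i hi => ht i fun h => hi (Finset.mem_union_right _ h)]
  simp_rw [hab]

/-! ### The summands of `Φ_h f` and their sum -/

theorem isGivenBy_summand (hp : 1 ≤ p) (hQ : IsAdmissibleCover O Q) (hh : IsTame φ h)
    (hv : LocGiven φ p f v) (i : I) :
    IsGivenBy (𝓕⁻ (genProd (starSymbol Q φ h i) (testMul (φ i) (fourierZ' f))))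
      (starKer Q φ h i ⋆[ContinuousLinearMap.mul ℂ ℂ, volume] v i) :=
  isGivenBy_fourierInv_genProd hp (memLp_starKer hQ hh i) (hv i).1
    (isGivenBy_fourierInv_starSymbol hQ hh i) (hv i).2

theorem isGenProd_genProd (hp : 1 ≤ p) (hQ : IsAdmissibleCover O Q) (hh : IsTame φ h)
    (hv : LocGiven φ p f v) (i : I) :
    IsGenProd p (starSymbol Q φ h i) (testMul (φ i) (fourierZ' f))
      (genProd (starSymbol Q φ h i) (testMul (φ i) (fourierZ' f))) :=
  ⟨_, _, memLp_starKer hQ hh i, (hv i).1, isGivenBy_fourierInv_starSymbol hQ hh i, (hv i).2,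
    isGivenBy_summand hp hQ hh hv i⟩

theorem fourierZ'_toZ' (T : 𝓢'(Rd d, ℂ)) (η : 𝓓(O, ℂ)) :
    fourierZ' (toZ' O (𝓕⁻ T)) η = T (testToSchwartz O η) := by
  change T (𝓕⁻ (𝓕 (testToSchwartz O η))) = _
  rw [FourierTransform.fourierInv_fourier_eq]

theorem fourierZ'_multSummand (hp : 1 ≤ p) (hQ : IsAdmissibleCover O Q) (hh : IsTame φ h)
    (hv : LocGiven φ p f v) (i : I) (η : 𝓓(O, ℂ)) :
    fourierZ' (multSummand Q φ h f i) η =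
      ∫ y, starKer Q φ h i y * fourierZ' f (modT y (mulTest (φ i) (testToSchwartz O η))) := by
  rw [multSummand, fourierZ'_toZ', genProd_apply hp (memLp_starKer hQ hh i) (hv i).1
    (isGivenBy_fourierInv_starSymbol hQ hh i) (hv i).2]
  simp_rw [← mulTest_modS]
  rfl

theorem fourierZ'_multSummand_eq_zero (hp : 1 ≤ p) (hQ : IsAdmissibleCover O Q) (hh : IsTame φ h)
    (hv : LocGiven φ p f v) {i : I} {η : 𝓓(O, ℂ)} (hi : ∀ ξ, φ i ξ * η ξ = 0) :
    fourierZ' (multSummand Q φ h f i) η = 0 := by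
  have h0 : ∀ y, modT y (mulTest (φ i) (testToSchwartz O η)) = 0 := fun y =>
    TestFunction.ext fun ξ => by
      rw [modT_apply, mulTest_apply, testToSchwartz_apply, hi, mul_zero]; rfl
  simp [fourierZ'_multSummand hp hQ hh hv, h0]

theorem summable_multSummand (hp : 1 ≤ p) (hφ : IsBAPU Q φ) (hQ : IsAdmissibleCover O Q)
    (hh : IsTame φ h) (hv : LocGiven φ p f v) : Summable (multSummand Q φ h f) := by
  refine summable_of_locallyFinite _ fun K hK hKO => ?_
  obtain ⟨s, hs⟩ := hφ.exists_finset_of_isCompact hQ hK hKO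
  refine ⟨s, fun i hi η hη => fourierZ'_multSummand_eq_zero hp hQ hh hv fun ξ => ?_⟩
  by_cases hξ : ξ ∈ K
  · rw [hs i hi ξ hξ, zero_mul]
  · rw [image_eq_zero_of_notMem_tsupport fun h' => hξ (hη h'), mul_zero]

theorem fourierZ'_mult (hp : 1 ≤ p) (hφ : IsBAPU Q φ) (hQ : IsAdmissibleCover O Q)
    (hh : IsTame φ h) (hv : LocGiven φ p f v) {η : 𝓓(O, ℂ)} {s : Finset I}
    (hs : ∀ i ∉ s, ∀ ξ, φ i ξ * η ξ = 0) :
    fourierZ' (mult Q φ h f) η = ∑ i ∈ s,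
      ∫ y, starKer Q φ h i y * fourierZ' f (modT y (mulTest (φ i) (testToSchwartz O η))) := by
  rw [mult, fourierZ'_tsum (summable_multSummand hp hφ hQ hh hv)
    fun i hi => fourierZ'_multSummand_eq_zero hp hQ hh hv (hs i hi)]
  exact Finset.sum_congr rfl fun i _ => fourierZ'_multSummand hp hQ hh hv i η

end Pairing

/-! ### Weighted sequence norms -/

section Lqw

variable {q : ℝ≥0∞} {w : I → ℝ} {c c' : I → ℝ≥0∞}

theorem lqwNorm_mono (h : ∀ i, c i ≤ c' i) : lqwNorm q w c ≤ lqwNorm q w c' := by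
  unfold lqwNorm
  split_ifs
  · exact iSup_mono fun i => by gcongr; exact h i
  · gcongr with i
    exact h i

theorem toReal_pos_of_one_le (hq : 1 ≤ q) (hqt : q ≠ ⊤) : 0 < q.toReal :=
  ENNReal.toReal_pos (zero_lt_one.trans_le hq).ne' hqt

theorem lqwNorm_const_mul (hq : 1 ≤ q) (C : ℝ≥0∞) :
    lqwNorm q w (fun i => C * c i) = C * lqwNorm q w c := by
  unfold lqwNorm
  simp_rw [mul_left_comm _ C]
  split_ifs with h
  · rw [ENNReal.mul_iSup]
  · have hq0 := toReal_pos_of_one_le hq h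
    simp_rw [ENNReal.mul_rpow_of_nonneg _ _ hq0.le]
    rw [ENNReal.tsum_mul_left, ENNReal.mul_rpow_of_nonneg _ _ (by positivity), ← ENNReal.rpow_mul,
      mul_one_div_cancel hq0.ne', ENNReal.rpow_one]

theorem lt_top_of_lqwNorm_lt_top (hq : 1 ≤ q) (hw : ∀ i, 0 < w i) (h : lqwNorm q w c < ⊤) (i : I) :
    c i < ⊤ := by
  have hwi : ENNReal.ofReal (w i) ≠ 0 := by simpa using hw i
  have h1 : ENNReal.ofReal (w i) * c i < ⊤ := by
    unfold lqwNorm at h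
    split_ifs at h with hqt
    · exact (le_iSup (fun i => ENNReal.ofReal (w i) * c i) i).trans_lt h
    · have hq0 := toReal_pos_of_one_le hq hqt
      rw [ENNReal.rpow_lt_top_iff_of_pos (by positivity)] at h
      exact (ENNReal.rpow_lt_top_iff_of_pos hq0).1 ((ENNReal.le_tsum i).trans_lt h)
  exact ENNReal.lt_top_of_mul_ne_top_right h1.ne hwi

theorem lqwNorm_add_lt_top (hq : 1 ≤ q) (h : lqwNorm q w c < ⊤) (h' : lqwNorm q w c' < ⊤) :
    lqwNorm q w (fun i => c i + c' i) < ⊤ := by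
  unfold lqwNorm at *
  simp_rw [mul_add]
  split_ifs at * with hqt
  · refine lt_of_le_of_lt (iSup_le fun i => add_le_add ?_ ?_) (ENNReal.add_lt_top.2 ⟨h, h'⟩)
    · exact le_iSup (fun i => ENNReal.ofReal (w i) * c i) i
    · exact le_iSup (fun i => ENNReal.ofReal (w i) * c' i) i
  · have hq0 := toReal_pos_of_one_le hq hqt
    have hq1 : 1 ≤ q.toReal := by
      rw [← ENNReal.toReal_one]; exact ENNReal.toReal_mono hqt hq
    rw [ENNReal.rpow_lt_top_iff_of_pos (by positivity)] at *
    -- Only finiteness is needed, so the convexity bound (a + b)^r ≤ 2^(r - 1)(a^r + b^r) replaces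
    -- Minkowski.
    refine lt_of_le_of_lt (ENNReal.tsum_le_tsum fun i =>
      ENNReal.rpow_add_le_mul_rpow_add_rpow _ _ hq1) ?_
    rw [ENNReal.tsum_mul_left, ENNReal.tsum_add]
    exact ENNReal.mul_lt_top (ENNReal.rpow_lt_top_of_nonneg (by linarith) (by simp))
      (ENNReal.add_lt_top.2 ⟨h, h'⟩)

end Lqw

/-! ### Localizations of `Φ_h f` -/

section Localize

variable {Q : I → Set (Rd d)} {φ : I → 𝓓(O, ℂ)} {h : Rd d → ℂ} {p q : ℝ≥0∞} {w : I → ℝ}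
  {f : FourierDist O} {v : I → Rd d → ℂ}

theorem exists_locGiven (hq : 1 ≤ q) (hw : IsModerateWeight Q w) (hf : f ∈ decompSpace φ p q w) :
    ∃ v, LocGiven φ p f v ∧ ∀ i, eLpNorm (v i) p volume = distLpNorm p (localize (φ i) f) := by
  choose v hv1 hv2 hv3 using fun i =>
    exists_of_distLpNorm_lt_top (lt_top_of_lqwNorm_lt_top hq hw.pos hf i)
  exact ⟨v, fun i => ⟨hv1 i, hv2 i⟩, hv3⟩

/-- The inverse Fourier transform of a test function, as a Schwartz function. -/
def invKer (φ : 𝓓(O, ℂ)) : 𝓢(Rd d, ℂ) := 𝓕⁻ (testToSchwartz O φ)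

theorem fourier_invKer (φ : 𝓓(O, ℂ)) : 𝓕 (invKer φ : Rd d → ℂ) = φ := by
  rw [← SchwartzMap.fourier_coe, invKer, FourierTransform.fourier_fourierInv_eq]
  rfl

theorem eLpNorm_invKer_le (φ : I → 𝓓(O, ℂ)) (i : I) :
    eLpNorm (invKer (φ i)) 1 volume ≤ bapuConst φ := by
  rw [invKer, SchwartzMap.fourierInv_coe]
  exact le_iSup (fun i => eLpNorm (𝓕⁻ (φ i : Rd d → ℂ)) 1 volume) i

theorem fourier_mulTest_apply (φ : 𝓓(O, ℂ)) (g : 𝓢(Rd d, ℂ)) (x : Rd d) :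
    𝓕 (testToSchwartz O (mulTest φ g)) x = ∫ y, invKer φ y * 𝓕 g (x + y) := by
  have := fourier_mul_fourier (invKer φ).integrable g.integrable x
  rw [fourier_invKer] at this
  exact this

/-- The density of `𝓕⁻¹(φ_j · \hat{Φ_h f})`. -/
def multDensity (hQ : IsAdmissibleCover O Q) (φ : I → 𝓓(O, ℂ)) (h : Rd d → ℂ) (v : I → Rd d → ℂ)
    (j : I) : Rd d → ℂ :=
  ∑ i ∈ hQ.clusterF j, ((invKer (φ i) : Rd d → ℂ) ⋆[ContinuousLinearMap.mul ℂ ℂ, volume]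
    (starKer Q φ h i ⋆[ContinuousLinearMap.mul ℂ ℂ, volume] v j))

theorem memLp_multDensity_summand (hp : 1 ≤ p) (hQ : IsAdmissibleCover O Q) (hh : IsTame φ h)
    (hv : LocGiven φ p f v) (i j : I) :
    MemLp ((invKer (φ i) : Rd d → ℂ) ⋆[ContinuousLinearMap.mul ℂ ℂ, volume]
      (starKer Q φ h i ⋆[ContinuousLinearMap.mul ℂ ℂ, volume] v j)) p volume :=
  memLp_convolution hp ((invKer (φ i)).memLp 1)
    (memLp_convolution hp (memLp_starKer hQ hh i) (hv j).1)

/-- Only i ∈ j^* survive, because φ_i φ_j = 0 otherwise. -/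
theorem isGivenBy_multDensity (hp : 1 ≤ p) (hφ : IsBAPU Q φ) (hQ : IsAdmissibleCover O Q)
    (hh : IsTame φ h) (hv : LocGiven φ p f v) (j : I) :
    IsGivenBy (localize (φ j) (mult Q φ h f)) (multDensity hQ φ h v j) := fun g => by
  have := ENNReal.HolderConjugate.inv_one_sub_inv' hp
  have hg := g.memLp (1 - p⁻¹)⁻¹ volume
  have hm := memLp_multDensity_summand hp hQ hh hv
  refine ⟨(memLp_finsetSum' _ fun i _ => hm i j).integrable_mul hg, ?_⟩
  change fourierZ' (mult Q φ h f) (mulTest (φ j) (𝓕⁻ g)) = _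
  rw [fourierZ'_mult hp hφ hQ hh hv (s := hQ.clusterF j) fun i hi ξ => by
    rw [mulTest_apply, ← mul_assoc, hφ.mul_eq_zero_of_notMem hQ hi, zero_mul]]
  simp_rw [multDensity, Finset.sum_apply, Finset.sum_mul]
  rw [integral_finsetSum _ fun i _ => integrable_mul_of_memLp (hm i j) hg]
  refine Finset.sum_congr rfl fun i _ => ?_
  -- Exchanging φ_i and φ_j puts φ_j next to f̂, so that `v j` appears instead of `v i`; the
  -- remaining φ_i becomes convolution with its inverse transform.
  have e1 : mulTest (φ i) (testToSchwartz O (mulTest (φ j) (𝓕⁻ g))) =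
      mulTest (φ j) (testToSchwartz O (mulTest (φ i) (𝓕⁻ g))) :=
    TestFunction.ext fun ξ => mul_left_comm (φ i ξ) (φ j ξ) (𝓕⁻ g ξ)
  rw [integral_convolution_mul ((invKer (φ i)).memLp 1)
    (memLp_convolution hp (memLp_starKer hQ hh i) (hv j).1) hg, integral_integral_mul_comp_add
      ((invKer (φ i)).memLp 1) (memLp_convolution hp (memLp_starKer hQ hh i) (hv j).1) hg]
  simp_rw [e1, fourierZ'_modT_mulTest (hv j).2]
  rw [← integral_convolution_mul (memLp_starKer hQ hh i) (hv j).1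
    ((𝓕 (testToSchwartz O (mulTest (φ i) (𝓕⁻ g)))).memLp (1 - p⁻¹)⁻¹)]
  simp_rw [fourier_mulTest_apply, FourierTransform.fourier_fourierInv_eq]

theorem locGiven_mult (hp : 1 ≤ p) (hφ : IsBAPU Q φ) (hQ : IsAdmissibleCover O Q)
    (hh : IsTame φ h) (hv : LocGiven φ p f v) :
    LocGiven φ p (mult Q φ h f) (multDensity hQ φ h v) := fun j =>
  ⟨memLp_finsetSum' _ fun i _ => memLp_multDensity_summand hp hQ hh hv i j,
    isGivenBy_multDensity hp hφ hQ hh hv j⟩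

/-- The bound shared by the density of `Φ_h f` and its dominating function. -/
theorem sum_eLpNorm_le (hQ : IsAdmissibleCover O Q) (φ : I → 𝓓(O, ℂ)) (h : Rd d → ℂ)
    {A : I → ℝ≥0∞} {c : ℝ≥0∞} (j : I)
    (hA : ∀ i, A i ≤ bapuConst φ * ((overlapNum Q : ℝ≥0∞) * tameConst φ h * c)) :
    ∑ i ∈ hQ.clusterF j, A i ≤
      (overlapNum Q : ℝ≥0∞) ^ 2 * bapuConst φ * tameConst φ h * c := by
  refine (Finset.sum_le_card_nsmul _ _ _ fun i _ => hA i).trans ?_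
  rw [nsmul_eq_mul]
  calc _ ≤ (overlapNum Q : ℝ≥0∞) *
        (bapuConst φ * ((overlapNum Q : ℝ≥0∞) * tameConst φ h * c)) := by
        gcongr; exact hQ.card_clusterF_le j
    _ = _ := by ring

/-- Young's inequality twice in each summand gives C_Φ and N C_h; the second factor N counts the
summands. -/
theorem eLpNorm_multDensity_le (hp : 1 ≤ p) (hQ : IsAdmissibleCover O Q)
    (hh : IsTame φ h) (hv : LocGiven φ p f v) (j : I) :
    eLpNorm (multDensity hQ φ h v j) p volume ≤
      (overlapNum Q : ℝ≥0∞) ^ 2 * bapuConst φ * tameConst φ h * eLpNorm (v j) p volume := by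
  refine (eLpNorm_sum_le (fun i _ => (memLp_multDensity_summand hp hQ hh hv i j).1) hp).trans
    (sum_eLpNorm_le hQ φ h j fun i => ?_)
  refine (eLpNorm_convolution_le hp ((invKer (φ i)).memLp 1).1
    (memLp_convolution hp (memLp_starKer hQ hh i) (hv j).1).1).trans ?_
  gcongr
  · exact eLpNorm_invKer_le φ i
  · refine (eLpNorm_convolution_le hp (memLp_starKer hQ hh i).1 (hv j).1.1).trans ?_
    gcongr
    exact eLpNorm_starKer_le hQ hh i

theorem const_lt_top (hφ : IsBAPU Q φ) (hQ : IsAdmissibleCover O Q) (hh : IsTame φ h) :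
    (overlapNum Q : ℝ≥0∞) ^ 2 * bapuConst φ * tameConst φ h < ⊤ :=
  ENNReal.mul_lt_top (ENNReal.mul_lt_top (ENNReal.pow_lt_top (by
    simpa using hQ.overlap_lt_top)) hφ.const_lt_top) hh.const_lt_top

theorem decompNorm_mult_le (hp : 1 ≤ p) (hq : 1 ≤ q) (hφ : IsBAPU Q φ)
    (hQ : IsAdmissibleCover O Q) (hh : IsTame φ h) (hw : IsModerateWeight Q w)
    (hf : f ∈ decompSpace φ p q w) :
    decompNorm φ p q w (mult Q φ h f) ≤
      (overlapNum Q : ℝ≥0∞) ^ 2 * bapuConst φ * tameConst φ h * decompNorm φ p q w f := by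
  obtain ⟨v, hv, hv'⟩ := exists_locGiven hq hw hf
  rw [decompNorm, decompNorm, ← lqwNorm_const_mul hq]
  refine lqwNorm_mono fun j => ?_
  obtain ⟨h1, h2⟩ := locGiven_mult hp hφ hQ hh hv j
  refine (distLpNorm_le h1 h2).trans ?_
  rw [← hv']
  exact eLpNorm_multDensity_le hp hQ hh hv j

theorem mult_mem_decompSpace (hp : 1 ≤ p) (hq : 1 ≤ q) (hφ : IsBAPU Q φ)
    (hQ : IsAdmissibleCover O Q) (hh : IsTame φ h) (hw : IsModerateWeight Q w)
    (hf : f ∈ decompSpace φ p q w) : mult Q φ h f ∈ decompSpace φ p q w :=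
  (decompNorm_mult_le hp hq hφ hQ hh hw hf).trans_lt
    (ENNReal.mul_lt_top (const_lt_top hφ hQ hh) hf)

/-! ### Linearity -/

theorem localize_add_smul (φ : 𝓓(O, ℂ)) (f g : FourierDist O) (a b : ℂ) :
    localize φ (a • f + b • g) = a • localize φ f + b • localize φ g := rfl

theorem LocGiven.add_smul {g : FourierDist O} {u : I → Rd d → ℂ} (hv : LocGiven φ p f v)
    (hu : LocGiven φ p g u) (a b : ℂ) :
    LocGiven φ p (a • f + b • g) (fun i => a • v i + b • u i) := fun i => by
  refine ⟨((hv i).1.const_smul a).add ((hu i).1.const_smul b), ?_⟩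
  rw [localize_add_smul]
  exact ((hv i).2.smul a).add ((hu i).2.smul b)

theorem add_smul_mem_decompSpace (hp : 1 ≤ p) (hq : 1 ≤ q) (hw : IsModerateWeight Q w)
    {g : FourierDist O} (hf : f ∈ decompSpace φ p q w) (hg : g ∈ decompSpace φ p q w) (a b : ℂ) :
    a • f + b • g ∈ decompSpace φ p q w := by
  obtain ⟨v, hv, hv'⟩ := exists_locGiven hq hw hf
  obtain ⟨u, hu, hu'⟩ := exists_locGiven hq hw hg
  have h1 : ∀ i, distLpNorm p (localize (φ i) (a • f + b • g)) ≤
      ‖a‖ₑ * distLpNorm p (localize (φ i) f) + ‖b‖ₑ * distLpNorm p (localize (φ i) g) := fun i => by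
    refine (distLpNorm_le (hv.add_smul hu a b i).1 (hv.add_smul hu a b i).2).trans ?_
    refine (eLpNorm_add_le ((hv i).1.const_smul a).1 ((hu i).1.const_smul b).1 hp).trans ?_
    rw [eLpNorm_const_smul, eLpNorm_const_smul, hv', hu']
  refine (lqwNorm_mono h1).trans_lt (lqwNorm_add_lt_top hq ?_ ?_)
  · rw [lqwNorm_const_mul hq]; exact ENNReal.mul_lt_top enorm_lt_top hf
  · rw [lqwNorm_const_mul hq]; exact ENNReal.mul_lt_top enorm_lt_top hg

theorem mult_add_smul (hp : 1 ≤ p) (hφ : IsBAPU Q φ) (hQ : IsAdmissibleCover O Q)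
    (hh : IsTame φ h) {g : FourierDist O} {u : I → Rd d → ℂ} (hv : LocGiven φ p f v)
    (hu : LocGiven φ p g u) (a b : ℂ) :
    mult Q φ h (a • f + b • g) = a • mult Q φ h f + b • mult Q φ h g := by
  refine fourierDist_ext fun η => ?_
  obtain ⟨s, hs⟩ := hφ.exists_finset hQ η
  have e : fourierZ' (a • mult Q φ h f + b • mult Q φ h g) η =
    a * fourierZ' (mult Q φ h f) η + b * fourierZ' (mult Q φ h g) η := rfl
  rw [e, fourierZ'_mult hp hφ hQ hh hv hs, fourierZ'_mult hp hφ hQ hh hu hs,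
    fourierZ'_mult hp hφ hQ hh (hv.add_smul hu a b) hs, Finset.mul_sum, Finset.mul_sum,
    ← Finset.sum_add_distrib]
  refine Finset.sum_congr rfl fun i _ => ?_
  have hi := memLp_starKer hQ hh i
  rw [← integral_const_mul, ← integral_const_mul, ← integral_add
    ((integrable_mul_fourierZ'_modT hp hφ hQ hv hi _).const_mul a)
    ((integrable_mul_fourierZ'_modT hp hφ hQ hu hi _).const_mul b)]
  refine integral_congr_ae (Eventually.of_forall fun y => ?_)
  have e' : ∀ ψ, fourierZ' (a • f + b • g) ψ = a * fourierZ' f ψ + b * fourierZ' g ψ :=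
    fun _ => rfl
  simp only [e']
  ring

end Localize

/-! ### Symbols acting on distributions whose transform is a function; products of symbols -/

section Symbols

variable {Q : I → Set (Rd d)} {φ : I → 𝓓(O, ℂ)} {h g : Rd d → ℂ} {p q : ℝ≥0∞} {w : I → ℝ}
  {f : FourierDist O} {v : I → Rd d → ℂ}

theorem starFun_mul (hφ : IsBAPU Q φ) (hQ : IsAdmissibleCover O Q) (h : Rd d → ℂ) (i : I)
    (ξ : Rd d) : starFun Q φ h i ξ * φ i ξ = φ i ξ * h ξ := by
  rw [starFun, mul_right_comm, hφ.phiStar_mul hQ]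

theorem integral_mul_fourier {a η : Rd d → ℂ} (ha : Integrable a volume)
    (hη : Integrable η volume) : ∫ y, a y * 𝓕 η y = ∫ ξ, 𝓕 a ξ * η ξ := by
  have := fourier_mul_fourier ha hη 0
  simp_rw [zero_add] at this
  rw [← this, Real.fourier_eq]
  simp

/-- Here f̂ on a modulated test function ψ is 𝓕(kψ)(y), so the multiplication formula replaces each
kernel by its symbol φ_i^* h. Then φ_i^* φ_i = φ_i, and the φ_i sum to 1 on the support of η. -/
theorem mult_of_function (hp : 1 ≤ p) (hφ : IsBAPU Q φ) (hQ : IsAdmissibleCover O Q)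
    (hh : IsTame φ h) (hv : LocGiven φ p f v) {k : Rd d → ℂ} (hk : Continuous k)
    (hkc : HasCompactSupport k) (hkO : tsupport k ⊆ O)
    (hfk : ∀ η : 𝓓(O, ℂ), fourierZ' f η = ∫ ξ, k ξ * η ξ) :
    mult Q φ h f = toZ' O (𝓕⁻ (ofFun fun ξ => h ξ * k ξ)) := by
  refine fourierDist_ext fun η => ?_
  obtain ⟨s, hs⟩ := hφ.exists_finset hQ η
  have hkh : Continuous fun ξ => k ξ * h ξ :=
    continuous_mul_of_tsupport_subset hk hkO hh.continuousOn
  have hgiven : IsGivenBy (ofFun fun ξ => h ξ * k ξ) (fun ξ => h ξ * k ξ) := by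
    refine isGivenBy_ofFun (exists_isGivenBy le_rfl ?_)
    simp_rw [mul_comm (h _)]
    exact memLp_one_of_mul hk hkc hkO hh.continuousOn
  rw [fourierZ'_toZ', (hgiven _).2, fourierZ'_mult hp hφ hQ hh hv hs]
  have e : ∀ i, ∫ y, starKer Q φ h i y *
      fourierZ' f (modT y (mulTest (φ i) (testToSchwartz O η))) =
      ∫ ξ, (k ξ * h ξ) * (φ i ξ * η ξ) := by
    intro i
    have hint : Integrable (fun ξ => k ξ * (φ i ξ * η ξ)) volume :=
      (hk.mul ((φ i).continuous.mul η.continuous)).integrable_of_hasCompactSupport hkc.mul_right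
    have e1 : ∀ y, fourierZ' f (modT y (mulTest (φ i) (testToSchwartz O η))) =
        𝓕 (fun ξ => k ξ * (φ i ξ * η ξ)) y := by
      intro y
      rw [hfk, Real.fourier_eq]
      refine integral_congr_ae (Eventually.of_forall fun ξ => ?_)
      simp only [modT_apply, mulTest_apply, testToSchwartz_apply, Circle.smul_def, smul_eq_mul,
        real_inner_comm]
      ring
    simp_rw [e1]
    rw [integral_mul_fourier (memLp_one_iff_integrable.1 (memLp_starKer hQ hh i)) hint,
      fourier_starKer hQ hh]
    refine integral_congr_ae (Eventually.of_forall fun ξ => ?_)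
    simp only
    calc _ = k ξ * (starFun Q φ h i ξ * φ i ξ) * η ξ := by ring
      _ = _ := by rw [starFun_mul hφ hQ]; ring
  simp_rw [e]
  have hint : ∀ i, Integrable (fun ξ => (k ξ * h ξ) * (φ i ξ * η ξ)) volume := fun i =>
    (hkh.mul ((φ i).continuous.mul η.continuous)).integrable_of_hasCompactSupport
      hkc.mul_right.mul_right
  rw [← integral_finsetSum _ fun i _ => hint i]
  refine integral_congr_ae (Eventually.of_forall fun ξ => ?_)
  simp only
  rw [← Finset.mul_sum, hφ.sum_mul_eq hs, testToSchwartz_apply]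
  ring

/-- Since φ_i g h = (φ_i^* g)(φ_i h), the inverse transform is a convolution of `L^1` functions, and
Young gives C_{gh} ≤ N C_g C_h. -/
theorem IsTame.mul (hφ : IsBAPU Q φ) (hQ : IsAdmissibleCover O Q) (hg : IsTame φ g)
    (hh : IsTame φ h) : IsTame φ (fun ξ => g ξ * h ξ) := by
  refine ⟨hg.continuousOn.mul hh.continuousOn, ?_⟩
  refine lt_of_le_of_lt (iSup_le fun i => ?_) (ENNReal.mul_lt_top (ENNReal.mul_lt_top
    (show (overlapNum Q : ℝ≥0∞) < ⊤ by simpa using hQ.overlap_lt_top) hg.const_lt_top)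
    hh.const_lt_top)
  have e : (fun ξ => φ i ξ * (g ξ * h ξ)) =
      fun ξ => starFun Q φ g i ξ * (φ i ξ * h ξ) := by
    funext ξ
    rw [← mul_assoc, ← mul_assoc, starFun_mul hφ hQ]
  rw [e, fourierInv_mul (fourier_starKer hQ hg i) rfl
    (memLp_one_iff_integrable.1 (memLp_starKer hQ hg i)) (integrable_mul_tame (φ i) hh.continuousOn)]
  refine (eLpNorm_convolution_le le_rfl (memLp_starKer hQ hg i).1
    (memLp_fourierInv_mul_tame hh i).1).trans ?_
  gcongr
  · exact eLpNorm_starKer_le hQ hg i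
  · exact le_iSup (fun i => eLpNorm (𝓕⁻ (fun ξ => φ i ξ * h ξ)) 1 volume) i

theorem continuous_integral_mul_comp_add (hp : 1 ≤ p) {v : Rd d → ℂ} (hv : MemLp v p volume)
    (g : 𝓢(Rd d, ℂ)) : Continuous fun y => ∫ x, v x * g (x + y) := by
  have hv' : MemLp (fun x => v (-x)) p volume :=
    hv.comp_measurePreserving (Measure.measurePreserving_neg volume)
  refine (contDiff_integral_smul_schwartz hp hv' 0 g).continuous.congr fun y => ?_
  rw [← integral_neg_eq_self]
  refine integral_congr_ae (Eventually.of_forall fun x => ?_)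
  simp [sub_eq_add_neg, add_comm]

/-- Boundedness in y is what allows Fubini against two `L^1` kernels in `mult_mult`. -/
theorem memLp_top_fourierZ'_modT (hp : 1 ≤ p) (hφ : IsBAPU Q φ) (hQ : IsAdmissibleCover O Q)
    (hv : LocGiven φ p f v) (ψ : 𝓓(O, ℂ)) : MemLp (fun y => fourierZ' f (modT y ψ)) ⊤ volume := by
  have := ENNReal.HolderConjugate.inv_one_sub_inv' hp
  obtain ⟨s, hs⟩ := hφ.exists_finset hQ ψ
  simp_rw [fourierZ'_modT hφ hv hs]
  refine memLp_finsetSum _ fun k _ => ?_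
  refine memLp_top_of_bound
    (continuous_integral_mul_comp_add hp (hv k).1 _).aestronglyMeasurable _
    (Eventually.of_forall fun y => (norm_integral_le_integral_norm _).trans
      (norm_integral_mul_comp_add_le (hv k).1
        ((𝓕 (testToSchwartz O ψ)).memLp (1 - p⁻¹)⁻¹) y))

theorem mult_mult (hp : 1 ≤ p) (hφ : IsBAPU Q φ) (hQ : IsAdmissibleCover O Q)
    (hg : IsTame φ g) (hh : IsTame φ h) (hv : LocGiven φ p f v) :
    mult Q φ h (mult Q φ g f) = mult Q φ (fun ξ => g ξ * h ξ) f := by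
  refine fourierDist_ext fun η => ?_
  obtain ⟨s, hs⟩ := hφ.exists_finset hQ η
  have hgh := hg.mul hφ hQ hh
  rw [fourierZ'_mult hp hφ hQ hh (locGiven_mult hp hφ hQ hg hv) hs,
    fourierZ'_mult hp hφ hQ hgh hv hs]
  refine Finset.sum_congr rfl fun i _ => ?_
  set ψ := mulTest (φ i) (testToSchwartz O η) with hψ
  have hsψ : ∀ j ∉ s, ∀ ξ, φ j ξ * ψ ξ = 0 := fun j hj ξ => by
    rw [hψ, mulTest_apply, testToSchwartz_apply, mul_left_comm, hs j hj, mul_zero]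
  have hsm : ∀ y, ∀ j ∉ s, ∀ ξ, φ j ξ * modT y ψ ξ = 0 := fun y j hj ξ => by
    rw [modT_apply, mul_left_comm, hsψ j hj, mul_zero]
  have e1 : ∀ y j, mulTest (φ j) (testToSchwartz O (modT y ψ)) =
      modT y (mulTest (φ j) (testToSchwartz O ψ)) := fun y j => by
    rw [testToSchwartz_modT, mulTest_modS]
  have hc := memLp_top_fourierZ'_modT hp hφ hQ hv
  have hai := memLp_starKer hQ hh i
  have hgj := memLp_starKer hQ hg
  calc _ = ∫ y, ∑ j ∈ s, starKer Q φ h i y * ∫ z, starKer Q φ g j z *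
        fourierZ' f (modT (z + y) (mulTest (φ j) (testToSchwartz O ψ))) := by
        refine integral_congr_ae (Eventually.of_forall fun y => ?_)
        simp only
        rw [fourierZ'_mult hp hφ hQ hg hv (hsm y), Finset.mul_sum]
        simp_rw [e1, modT_modT]
    -- Modulations by y and z compose to y + z, so the double integral is a single one against the
    -- convolution of the kernels.
    _ = ∑ j ∈ s, ∫ x, (starKer Q φ h i ⋆[ContinuousLinearMap.mul ℂ ℂ, volume] starKer Q φ g j) x *
        fourierZ' f (modT x (mulTest (φ j) (testToSchwartz O ψ))) := by
        rw [integral_finsetSum _ fun j _ => integrable_mul_integral hai (hgj j) (hc _)]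
        exact Finset.sum_congr rfl fun j _ => (integral_convolution_mul hai (hgj j) (hc _)).symm
    -- Only symbols times φ_i φ_j η matter, and there both kernels have the symbol g h.
    _ = ∑ j ∈ s, ∫ x, starKer Q φ (fun ξ => g ξ * h ξ) i x *
        fourierZ' f (modT x (mulTest (φ j) (testToSchwartz O ψ))) := by
        refine Finset.sum_congr rfl fun j _ => integral_mul_fourierZ'_modT_congr hp hφ hQ hv
          (memLp_convolution le_rfl hai (hgj j)) (memLp_starKer hQ hgh i) fun ξ => ?_
        rw [Real.fourier_mul_convolution_eq (memLp_one_iff_integrable.1 hai)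
          (memLp_one_iff_integrable.1 (hgj j)), fourier_starKer hQ hh, fourier_starKer hQ hg,
          fourier_starKer hQ hgh, mulTest_apply, testToSchwartz_apply, hψ, mulTest_apply,
          testToSchwartz_apply]
        calc _ = (starFun Q φ h i ξ * φ i ξ) * (starFun Q φ g j ξ * φ j ξ) * η ξ := by ring
          _ = φ j ξ * (φ i ξ * (g ξ * h ξ)) * η ξ := by
            rw [starFun_mul hφ hQ, starFun_mul hφ hQ]; ring
          _ = φ j ξ * (starFun Q φ (fun ξ => g ξ * h ξ) i ξ * φ i ξ) * η ξ := by
            rw [starFun_mul hφ hQ]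
          _ = _ := by ring
    _ = _ := by
        rw [← integral_finsetSum _ fun j _ => integrable_mul_fourierZ'_modT hp hφ hQ hv
          (memLp_starKer hQ hgh i) _]
        refine integral_congr_ae (Eventually.of_forall fun y => ?_)
        simp only
        rw [← Finset.mul_sum, ← map_sum, ← modT_sum, hφ.sum_mulTest hsψ]

end Symbols

/-! ### Domination of convolutions -/

section DominatedConvolution

variable {p : ℝ≥0∞}

/-- The convolution integral of an `L^1` and an `L^p` function exists almost everywhere. -/
theorem ae_integrable_convolution (hp : 1 ≤ p) {a v : Rd d → ℝ} (ha : MemLp a 1 volume)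
    (hv : MemLp v p volume) : ∀ᵐ x, Integrable (fun t => a t * v (x - t)) volume := by
  have := ENNReal.HolderConjugate.inv_one_sub_inv' hp
  obtain ⟨k, hk⟩ := Measure.HasTemperateGrowth.exists_eLpNorm_lt_top (1 - p⁻¹)⁻¹
    (μ := (volume : Measure (Rd d))) inferInstance
  have hc : Continuous fun x : Rd d => (1 + ‖x‖) ^ (-k : ℝ) :=
    Continuous.rpow_const (by fun_prop) fun x => Or.inl (by positivity)
  have h := (integrable_triple_sub ha hv (q := (1 - p⁻¹)⁻¹)
    ⟨hc.aestronglyMeasurable, hk⟩).prod_right_ae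
  filter_upwards [h] with x hx
  have hpos : (1 + ‖x‖) ^ (-k : ℝ) ≠ 0 := (Real.rpow_pos_of_pos (by positivity) _).ne'
  refine (hx.mul_const ((1 + ‖x‖) ^ (-k : ℝ))⁻¹).congr (Eventually.of_forall fun t => ?_)
  simp only
  field_simp

/-- Only almost everywhere: where the right-hand integral diverges, its default value 0 bounds
nothing. -/
theorem ae_norm_convolution_le (hp : 1 ≤ p) {a v : Rd d → ℂ} {F : Rd d → ℝ}
    (ha : MemLp a 1 volume) (hF : MemLp F p volume) (hvF : ∀ x, ‖v x‖ ≤ F x) :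
    ∀ᵐ x, ‖(a ⋆[ContinuousLinearMap.mul ℂ ℂ, volume] v) x‖ ≤
      ((fun x => ‖a x‖) ⋆[ContinuousLinearMap.mul ℝ ℝ, volume] F) x := by
  filter_upwards [ae_integrable_convolution hp ha.norm hF] with x hx
  rw [convolution_mul, convolution_mul]
  refine norm_integral_le_of_norm_le hx (Eventually.of_forall fun t => ?_)
  rw [norm_mul]
  exact mul_le_mul_of_nonneg_left (hvF _) (norm_nonneg _)

/-- With conjugate exponents the convolution integral exists at every point, so an almost-everywhere
bound on `v` becomes a bound everywhere. The outer Schwartz kernel uses this to give domination at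
every x. -/
theorem norm_convolution_le {q : ℝ≥0∞} [p.HolderConjugate q] {a v : Rd d → ℂ} {F : Rd d → ℝ}
    (ha : MemLp a q volume) (hF : MemLp F p volume) (hvF : ∀ᵐ x, ‖v x‖ ≤ F x) (x : Rd d) :
    ‖(a ⋆[ContinuousLinearMap.mul ℂ ℂ, volume] v) x‖ ≤
      ((fun x => ‖a x‖) ⋆[ContinuousLinearMap.mul ℝ ℝ, volume] F) x := by
  rw [convolution_mul, convolution_mul]
  have hF' : MemLp (fun t => F (x - t)) p volume :=
    hF.comp_measurePreserving (Measure.measurePreserving_sub_left volume x)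
  have hi : Integrable (fun t => ‖a t‖ * F (x - t)) volume :=
    (integrable_mul_of_memLp hF' ha.norm).congr (Eventually.of_forall fun t => mul_comm _ _)
  refine norm_integral_le_of_norm_le hi ?_
  filter_upwards [(quasiMeasurePreserving_sub_left volume x).ae hvF] with t ht
  rw [norm_mul]
  exact mul_le_mul_of_nonneg_left ht (norm_nonneg _)

theorem convolution_nonneg {a F : Rd d → ℝ} (ha : ∀ x, 0 ≤ a x) (hF : ∀ x, 0 ≤ F x) (x : Rd d) :
    0 ≤ (a ⋆[ContinuousLinearMap.mul ℝ ℝ, volume] F) x := by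
  rw [convolution_mul]
  exact integral_nonneg fun t => mul_nonneg (ha t) (hF _)

end DominatedConvolution

/-! ### Dominated convergence -/

section Dominated

variable {Q : I → Set (Rd d)} {φ : I → 𝓓(O, ℂ)} {h : Rd d → ℂ} {p q : ℝ≥0∞} {w : I → ℝ}
  {f : FourierDist O} {v : I → Rd d → ℂ} {F : I → Rd d → ℝ}

theorem IsDominated.exists_locGiven (hF : ∀ i, MemLp (F i) p volume) (hf : IsDominated φ F f) :
    ∃ v, LocGiven φ p f v ∧ ∀ i x, ‖v i x‖ ≤ F i x := by
  choose v hv1 hv2 hv3 using hf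
  exact ⟨v, fun i => ⟨(hF i).mono' (hv1 i).continuous.aestronglyMeasurable
    (Eventually.of_forall (hv3 i)), hv2 i⟩, hv3⟩

theorem mem_decompSpace_of_locGiven (hF : IsDominating p q w F) (hv : LocGiven φ p f v)
    (hvF : ∀ i, ∀ᵐ x, ‖v i x‖ ≤ F i x) : f ∈ decompSpace φ p q w :=
  lt_of_le_of_lt (lqwNorm_mono fun i => (distLpNorm_le (hv i).1 (hv i).2).trans
    (eLpNorm_mono_ae_real (hvF i))) hF.norm_lt_top

/-- `φ_i^*` as a test function. -/
def starTest (hQ : IsAdmissibleCover O Q) (φ : I → 𝓓(O, ℂ)) (i : I) : 𝓓(O, ℂ) :=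
  ∑ l ∈ hQ.clusterF i, φ l

theorem mulTest_starTest (hφ : IsBAPU Q φ) (hQ : IsAdmissibleCover O Q) (i : I) :
    mulTest (φ i) (testToSchwartz O (starTest hQ φ i)) = φ i :=
  TestFunction.ext fun ξ => by
    rw [mulTest_apply, testToSchwartz_apply, starTest, testFunction_sum_apply,
      ← phiStar_eq_sum φ hQ, mul_comm, hφ.phiStar_mul hQ]

/-- The density of `𝓕⁻¹(φ_i f̂)` is `x ↦ f̂(φ_i e^{2πi x·})`. -/
theorem ae_eq_fourierZ'_modT (hp : 1 ≤ p) (hφ : IsBAPU Q φ) (hQ : IsAdmissibleCover O Q)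
    (hv : LocGiven φ p f v) (i : I) :
    ∀ᵐ x, v i x = fourierZ' f (modT (-x) (φ i)) := by
  have := ENNReal.HolderConjugate.inv_one_sub_inv' hp
  set χ := starTest hQ φ i with hχ
  -- From φ_i = φ_i φ_i^*, convolution with 𝓕⁻¹(φ_i^*) reproduces `v i` almost everywhere, and that
  -- convolution at x is a pairing with a modulated test function.
  have h1 : IsGivenBy (localize (φ i) f)
      ((invKer χ : Rd d → ℂ) ⋆[ContinuousLinearMap.mul ℂ ℂ, volume] v i) := fun g => by
    have hg := g.memLp (1 - p⁻¹)⁻¹ volume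
    have hb := (invKer χ).memLp 1 volume
    refine ⟨integrable_mul_of_memLp (memLp_convolution hp hb (hv i).1) hg, ?_⟩
    rw [integral_convolution_mul hb (hv i).1 hg, integral_integral_mul_comp_add hb (hv i).1 hg]
    change fourierZ' f (mulTest (φ i) (𝓕⁻ g)) = _
    have e : mulTest (φ i) (𝓕⁻ g) = mulTest (φ i) (testToSchwartz O (mulTest χ (𝓕⁻ g))) := by
      conv_lhs => rw [← mulTest_starTest hφ hQ i]
      exact TestFunction.ext fun ξ => mul_assoc _ _ _
    rw [e, fourierZ'_mulTest (hv i).2]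
    simp_rw [fourier_mulTest_apply, FourierTransform.fourier_fourierInv_eq]
  filter_upwards [(hv i).2.ae_eq h1] with x hx
  rw [hx]
  conv_rhs => rw [← mulTest_starTest hφ hQ i, fourierZ'_modT_mulTest (hv i).2]
  rw [convolution_mul_swap]
  refine integral_congr_ae (Eventually.of_forall fun z => ?_)
  simp only
  rw [mul_comm, invKer, SchwartzMap.fourierInv_coe, Real.fourierInv_eq_fourier_neg,
    ← SchwartzMap.fourier_coe]
  congr 2
  abel

/-- The candidate density is a value of f̂ at each x, hence the almost-everywhere limit of the given
densities. It inherits the bound by `F i`, and dominated convergence with majorant F_i |g|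
identifies it. -/
theorem locGiven_of_tendsto (hp : 1 ≤ p) (hφ : IsBAPU Q φ) (hQ : IsAdmissibleCover O Q)
    (hF : ∀ i, MemLp (F i) p volume) {fs : ℕ → FourierDist O} {vs : ℕ → I → Rd d → ℂ}
    (hvs : ∀ n, LocGiven φ p (fs n) (vs n)) (hvF : ∀ n i x, ‖vs n i x‖ ≤ F i x)
    (hlim : Tendsto fs atTop (𝓝 f)) :
    LocGiven φ p f (fun i x => fourierZ' f (modT (-x) (φ i))) ∧
      ∀ i, ∀ᵐ x, ‖fourierZ' f (modT (-x) (φ i))‖ ≤ F i x := by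
  have := ENNReal.HolderConjugate.inv_one_sub_inv' hp
  have hη := tendsto_fourierDist_iff.1 hlim
  have hpt : ∀ i, ∀ᵐ x, Tendsto (fun n => vs n i x) atTop
      (𝓝 (fourierZ' f (modT (-x) (φ i)))) := fun i => by
    filter_upwards [ae_all_iff.2 fun n => ae_eq_fourierZ'_modT hp hφ hQ (hvs n) i] with x hx
    simp_rw [hx]
    exact hη _
  have hle : ∀ i, ∀ᵐ x, ‖fourierZ' f (modT (-x) (φ i))‖ ≤ F i x := fun i => by
    filter_upwards [hpt i] with x hx
    exact le_of_tendsto hx.norm (Eventually.of_forall fun n => hvF n i x)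
  have hmem : ∀ i, MemLp (fun x => fourierZ' f (modT (-x) (φ i))) p volume := fun i =>
    (hF i).mono' (aestronglyMeasurable_of_tendsto_ae atTop (fun n => (hvs n i).1.1) (hpt i)) (hle i)
  refine ⟨fun i => ⟨hmem i, fun g => ?_⟩, hle⟩
  have hg := g.memLp (1 - p⁻¹)⁻¹ volume
  refine ⟨integrable_mul_of_memLp (hmem i) hg, ?_⟩
  have h1 : Tendsto (fun n => localize (φ i) (fs n) g) atTop (𝓝 (localize (φ i) f g)) :=
    hη (mulTest (φ i) (𝓕⁻ g))
  have h2 : Tendsto (fun n => ∫ x, vs n i x * g x) atTop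
      (𝓝 (∫ x, fourierZ' f (modT (-x) (φ i)) * g x)) := by
    refine tendsto_integral_of_dominated_convergence (fun x => F i x * ‖g x‖)
      (fun n => (hvs n i).1.1.mul hg.1) (integrable_mul_of_memLp (hF i) hg.norm)
      (fun n => Eventually.of_forall fun x => ?_) ?_
    · rw [norm_mul]
      exact mul_le_mul_of_nonneg_right (hvF n i x) (norm_nonneg _)
    · filter_upwards [hpt i] with x hx
      exact hx.mul_const _
  refine tendsto_nhds_unique h1 (h2.congr fun n => ?_)
  exact ((hvs n i).2 g).2.symm

theorem tendsto_mult (hp : 1 ≤ p) (hφ : IsBAPU Q φ) (hQ : IsAdmissibleCover O Q)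
    (hh : IsTame φ h) (hF : ∀ i, MemLp (F i) p volume) {fs : ℕ → FourierDist O}
    {vs : ℕ → I → Rd d → ℂ} (hvs : ∀ n, LocGiven φ p (fs n) (vs n))
    (hvF : ∀ n i x, ‖vs n i x‖ ≤ F i x) (hv : LocGiven φ p f v)
    (hlim : Tendsto fs atTop (𝓝 f)) :
    Tendsto (fun n => mult Q φ h (fs n)) atTop (𝓝 (mult Q φ h f)) := by
  have := ENNReal.HolderConjugate.inv_one_sub_inv' hp
  refine tendsto_fourierDist_iff.2 fun η => ?_
  obtain ⟨s, hs⟩ := hφ.exists_finset hQ η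
  simp_rw [fun n => fourierZ'_mult hp hφ hQ hh (hvs n) hs, fourierZ'_mult hp hφ hQ hh hv hs]
  refine tendsto_finsetSum _ fun i _ => ?_
  have hi := memLp_starKer hQ hh i
  have hg := (𝓕 (testToSchwartz O η)).memLp (1 - p⁻¹)⁻¹ volume
  -- Weak-* convergence gives the limit for each y; Hölder, uniformly in n and y, gives the constant
  -- ‖F_i‖_p ‖𝓕η‖_{p'} in the majorant.
  refine tendsto_integral_of_dominated_convergence (fun y => ‖starKer Q φ h i y‖ *
      (eLpNorm (F i) p volume *
        eLpNorm (𝓕 (testToSchwartz O η) : 𝓢(Rd d, ℂ)) (1 - p⁻¹)⁻¹ volume).toReal)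
    (fun n => (integrable_mul_fourierZ'_modT hp hφ hQ (hvs n) hi _).1)
    ((memLp_one_iff_integrable.1 hi).norm.mul_const _)
    (fun n => Eventually.of_forall fun y => ?_)
    (Eventually.of_forall fun y => (tendsto_fourierDist_iff.1 hlim _).const_mul _)
  rw [norm_mul, fourierZ'_modT_mulTest (hvs n i).2]
  refine mul_le_mul_of_nonneg_left ?_ (norm_nonneg _)
  refine (norm_integral_le_integral_norm _).trans
    ((norm_integral_mul_comp_add_le (hvs n i).1 hg y).trans ?_)
  refine ENNReal.toReal_mono (ENNReal.mul_ne_top (hF i).2.ne hg.2.ne) ?_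
  gcongr
  exact eLpNorm_mono_real (hvF n i)

/-- The family dominating `Φ_h f` when `f` is dominated by `F`. -/
def multDominating (hQ : IsAdmissibleCover O Q) (φ : I → 𝓓(O, ℂ)) (h : Rd d → ℂ)
    (F : I → Rd d → ℝ) (j : I) : Rd d → ℝ :=
  ∑ i ∈ hQ.clusterF j, ((fun x => ‖invKer (φ i) x‖) ⋆[ContinuousLinearMap.mul ℝ ℝ, volume]
    ((fun x => ‖starKer Q φ h i x‖) ⋆[ContinuousLinearMap.mul ℝ ℝ, volume] F j))

theorem memLp_multDominating_summand (hp : 1 ≤ p) (hQ : IsAdmissibleCover O Q)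
    (hh : IsTame φ h) (hF : ∀ i, MemLp (F i) p volume) (i j : I) :
    MemLp ((fun x => ‖invKer (φ i) x‖) ⋆[ContinuousLinearMap.mul ℝ ℝ, volume]
      ((fun x => ‖starKer Q φ h i x‖) ⋆[ContinuousLinearMap.mul ℝ ℝ, volume] F j)) p volume :=
  memLp_convolution hp ((invKer (φ i)).memLp 1).norm
    (memLp_convolution hp (memLp_starKer hQ hh i).norm (hF j))

theorem eLpNorm_multDominating_le (hp : 1 ≤ p) (hQ : IsAdmissibleCover O Q)
    (hh : IsTame φ h) (hF : ∀ i, MemLp (F i) p volume) (j : I) :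
    eLpNorm (multDominating hQ φ h F j) p volume ≤
      (overlapNum Q : ℝ≥0∞) ^ 2 * bapuConst φ * tameConst φ h * eLpNorm (F j) p volume := by
  refine (eLpNorm_sum_le (fun i _ => (memLp_multDominating_summand hp hQ hh hF i j).1) hp).trans
    (sum_eLpNorm_le hQ φ h j fun i => ?_)
  refine (eLpNorm_convolution_le hp ((invKer (φ i)).memLp 1).norm.1
    (memLp_convolution hp (memLp_starKer hQ hh i).norm (hF j)).1).trans ?_
  rw [eLpNorm_norm]
  gcongr
  · exact eLpNorm_invKer_le φ i
  · refine (eLpNorm_convolution_le hp (memLp_starKer hQ hh i).norm.1 (hF j).1).trans ?_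
    rw [eLpNorm_norm]
    gcongr
    exact eLpNorm_starKer_le hQ hh i

theorem mixedNorm_multDominating_le (hp : 1 ≤ p) (hq : 1 ≤ q) (hQ : IsAdmissibleCover O Q)
    (hh : IsTame φ h) (hF : ∀ i, MemLp (F i) p volume) :
    mixedNorm p q w (multDominating hQ φ h F) ≤
      (overlapNum Q : ℝ≥0∞) ^ 2 * bapuConst φ * tameConst φ h * mixedNorm p q w F := by
  rw [mixedNorm, mixedNorm, ← lqwNorm_const_mul hq]
  exact lqwNorm_mono fun j => eLpNorm_multDominating_le hp hQ hh hF j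

theorem isDominating_multDominating (hp : 1 ≤ p) (hq : 1 ≤ q) (hφ : IsBAPU Q φ)
    (hQ : IsAdmissibleCover O Q) (hh : IsTame φ h) (hF : IsDominating p q w F) :
    IsDominating p q w (multDominating hQ φ h F) where
  nonneg j x := by
    rw [multDominating, Finset.sum_apply]
    exact Finset.sum_nonneg fun i _ => convolution_nonneg (fun _ => norm_nonneg _)
      (convolution_nonneg (fun _ => norm_nonneg _) (hF.nonneg j)) x
  memLp j := memLp_finsetSum' _ fun i _ => memLp_multDominating_summand hp hQ hh hF.memLp i j
  norm_lt_top := (mixedNorm_multDominating_le hp hq hQ hh hF.memLp).trans_lt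
    (ENNReal.mul_lt_top (const_lt_top hφ hQ hh) hF.norm_lt_top)

/-- The inner convolution is controlled only almost everywhere; the outer one, with a Schwartz
kernel, supplies both smoothness and the bound at every point. -/
theorem isDominated_mult (hp : 1 ≤ p) (hφ : IsBAPU Q φ) (hQ : IsAdmissibleCover O Q)
    (hh : IsTame φ h) (hF : ∀ i, MemLp (F i) p volume) (hv : LocGiven φ p f v)
    (hvF : ∀ i x, ‖v i x‖ ≤ F i x) :
    IsDominated φ (multDominating hQ φ h F) (mult Q φ h f) := fun j => by
  have := ENNReal.HolderConjugate.inv_one_sub_inv' hp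
  refine ⟨multDensity hQ φ h v j, ?_, isGivenBy_multDensity hp hφ hQ hh hv j, fun x => ?_⟩
  · rw [multDensity, Finset.sum_fn]
    exact ContDiff.sum fun i _ => contDiff_convolution_schwartz hp _
      (memLp_convolution hp (memLp_starKer hQ hh i) (hv j).1)
  · rw [multDensity, multDominating, Finset.sum_apply, Finset.sum_apply]
    refine norm_sum_le_of_le _ fun i _ => ?_
    exact norm_convolution_le (p := p) (q := (1 - p⁻¹)⁻¹) ((invKer (φ i)).memLp _)
      (memLp_convolution hp (memLp_starKer hQ hh i).norm (hF j))
      (ae_norm_convolution_le hp (memLp_starKer hQ hh i) (hF j) (hvF j)) x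

end Dominated

end DecompSpaces

end

theorem mainTheorem6 {d : ℕ} {I : Type*} (O : Opens (Rd d))
    (hO : (O : Set (Rd d)).Nonempty)
    (Q : I → Set (Rd d)) (hQ : IsAdmissibleCover O Q)
    (φ : I → 𝓓(O, ℂ)) (hφ : IsBAPU Q φ) :
    -- `Φ_h` for a fixed tame `h` on the spaces `𝓓(Q, L^p, ℓ^q_w)`
    (∀ (h : Rd d → ℂ), IsTame φ h →
      ∀ (p q : ℝ≥0∞) (w : I → ℝ), 1 ≤ p → 1 ≤ q → IsModerateWeight Q w →
      -- the summands are well defined and the series converges unconditionally in `Z'(O)`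
      (∀ f ∈ decompSpace φ p q w,
        (∀ i, IsGivenBy (starSymbol Q φ h i)
            (fun ξ => phiStar Q φ i ξ * h ξ)) ∧
        (∀ i, IsGenProd p (starSymbol Q φ h i)
          (testMul (φ i) (fourierZ' f))
          (genProd (starSymbol Q φ h i)
            (testMul (φ i) (fourierZ' f)))) ∧
        Summable (multSummand Q φ h f)) ∧
      -- (i) `Φ_h` is a bounded linear operator on the decomposition space
      (∀ f ∈ decompSpace φ p q w,
        mult Q φ h f ∈ decompSpace φ p q w ∧
        decompNorm φ p q w (mult Q φ h f) ≤
          (overlapNum Q : ℝ≥0∞) ^ 2 * bapuConst φ *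
            tameConst φ h * decompNorm φ p q w f) ∧
      (∀ f ∈ decompSpace φ p q w, ∀ g ∈ decompSpace φ p q w,
        ∀ a b : ℂ, a • f + b • g ∈ decompSpace φ p q w ∧
          mult Q φ h (a • f + b • g) =
            a • mult Q φ h f + b • mult Q φ h g) ∧
      -- (ii) dominated convergence
      (∀ (F : I → Rd d → ℝ), IsDominating p q w F →
        ∀ (fs : ℕ → FourierDist O) (f : FourierDist O),
        (∀ n, IsDominated φ F (fs n)) → Tendsto fs atTop (𝓝 f) →
        (∀ n, fs n ∈ decompSpace φ p q w) ∧
        f ∈ decompSpace φ p q w ∧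
        Tendsto (fun n => mult Q φ h (fs n)) atTop
          (𝓝 (mult Q φ h f)) ∧
        ∃ G : I → Rd d → ℝ, IsDominating p q w G ∧
          (∀ n, IsDominated φ G (mult Q φ h (fs n))) ∧
          mixedNorm p q w G ≤
            (overlapNum Q : ℝ≥0∞) ^ 2 * bapuConst φ *
              tameConst φ h * mixedNorm p q w F) ∧
      -- (iii) `Φ_h f = 𝓕⁻¹(h f̂)` if `f̂` is given by a function `k ∈ C_c(O)`
      (∀ f ∈ decompSpace φ p q w, ∀ k : Rd d → ℂ,
        Continuous k → HasCompactSupport k → tsupport k ⊆ O →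
        (∀ η : 𝓓(O, ℂ), fourierZ' f η = ∫ ξ, k ξ * η ξ) →
        mult Q φ h f =
          toZ' O (𝓕⁻ (ofFun fun ξ => h ξ * k ξ)))) ∧
    -- (iv) products of tame functions and composition of multipliers
    (∀ (g h : Rd d → ℂ), IsTame φ g → IsTame φ h →
      IsTame φ (fun ξ => g ξ * h ξ) ∧
      ∀ (p q : ℝ≥0∞) (w : I → ℝ), 1 ≤ p → 1 ≤ q → IsModerateWeight Q w →
      ∀ f ∈ decompSpace φ p q w,
        mult Q φ h (mult Q φ g f) =
          mult Q φ (fun ξ => g ξ * h ξ) f) := by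
  refine ⟨fun h hh p q w hp hq hw => ⟨fun f hf => ?_, fun f hf => ?_, fun f hf g hg a b => ?_,
    fun F hF fs f hfs hlim => ?_, fun f hf k hk hkc hkO hfk => ?_⟩, fun g h hg hh => ?_⟩
  · obtain ⟨v, hv, -⟩ := exists_locGiven hq hw hf
    exact ⟨isGivenBy_starSymbol hQ hh.continuousOn, isGenProd_genProd hp hQ hh hv,
      summable_multSummand hp hφ hQ hh hv⟩
  · exact ⟨mult_mem_decompSpace hp hq hφ hQ hh hw hf, decompNorm_mult_le hp hq hφ hQ hh hw hf⟩
  · obtain ⟨v, hv, -⟩ := exists_locGiven hq hw hf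
    obtain ⟨u, hu, -⟩ := exists_locGiven hq hw hg
    exact ⟨add_smul_mem_decompSpace hp hq hw hf hg a b, mult_add_smul hp hφ hQ hh hv hu a b⟩
  · choose vs hvs hvF using fun n => (hfs n).exists_locGiven hF.memLp
    obtain ⟨hv, hle⟩ := locGiven_of_tendsto hp hφ hQ hF.memLp hvs hvF hlim
    exact ⟨fun n => mem_decompSpace_of_locGiven hF (hvs n) fun i => Eventually.of_forall (hvF n i),
      mem_decompSpace_of_locGiven hF hv hle, tendsto_mult hp hφ hQ hh hF.memLp hvs hvF hv hlim,
      multDominating hQ φ h F, isDominating_multDominating hp hq hφ hQ hh hF,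
      fun n => isDominated_mult hp hφ hQ hh hF.memLp (hvs n) (hvF n),
      mixedNorm_multDominating_le hp hq hQ hh hF.memLp⟩
  · obtain ⟨v, hv, -⟩ := exists_locGiven hq hw hf
    exact mult_of_function hp hφ hQ hh hv hk hkc hkO hfk
  · refine ⟨hg.mul hφ hQ hh, fun p q w hp hq hw f hf => ?_⟩
    obtain ⟨v, hv, -⟩ := exists_locGiven hq hw hf
    exact mult_mult hp hφ hQ hg hh hv
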